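/- **Conventions.** A list is a finite unordered list of $n\ge 1$ real numbers (repetitions counted). We write $\sigma=(\lambda_1;\lambda_2,\dots,\lambda_n)$ to single out $\lambda_1$; the remaining entries, and likewise the diagonal entries $a_1,\dots,a_n$ below, are unordered. **Soules sets.** A real orthogonal $n\times n$ matrix $R$ is a *Soules matrix* if its first column is positive and $R\,\mathrm{diag}(l_1,\dots,l_n)R^T$ is entrywise nonnegative whenever $l_1\ge\dots\ge l_n\ge 0$. For $\lambda_1\ge\dots\ge\lambda_n$ and $a_1,\dots,a_n\ge0$, write $(\lambda_1;\lambda_2,\dots,\lambda_n)\in\mathcal S_n(a_1,\dots,a_n)$ if there is a Soules matrix $R$ such that $R\,\mathrm{diag}(\lambda_1,\dots,\lambda_n)R^T$ has diagonal elements $a_1,\dots,a_n$ (in some order). Write $(\lambda_1;\lambda_2,\dots,\lambda_n)\in\overline{\mathcal S}_n(a_1,\dots,a_n)$ if $(\lambda_1,\dots,\lambda_n)$ and $(a_1,\dots,a_n)$ can be partitioned into sublists $\sigma^{(1)},\dots,\sigma^{(k)}$ and $a^{(1)},\dots,a^{(k)}$, with $\sigma^{(i)}$ and $a^{(i)}$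 of the same length $n_i$, such that $\sigma^{(i)}\in\mathcal S_{n_i}(a^{(i)})$ for all $i$. Write $\sigma\in\overline{\mathcal S}_n$ if $\sigma\in\overline{\mathcal S}_n(a_1,\dots,a_n)$ for some $a_1,\dots,a_n\ge0$. **The sets $\mathcal H_n$.** For $a,a_1,a_2,\dots\ge 0$: $(\lambda)\in\mathcal H_1(a)$ iff $\lambda=a$; $(\lambda_1;\lambda_2)\in\mathcal H_2(a_1,a_2)$ iff $\lambda_1\ge\max\{a_1,a_2\}$ and $\lambda_1+\lambda_2=a_1+a_2$; for $m\ge3$, $(\lambda_1;\lambda_2,\dots,\lambda_m)\in\mathcal H_m(a_1,\dots,a_m)$ iff there are $1\le k\le m-2$, partitions $\{2,\dots,m\}=\{\alpha_1,\dots,\alpha_k\}\cup\{\beta_1,\dots,\beta_{m-k-1}\}$ and $\{1,\dots,m\}=\{\gamma_1,\dots,\gamma_k\}\cup\{\delta_1,\dots,\delta_{m-k}\}$, and $c\ge0$ with $(\lambda_1;\lambda_{\alpha_1},\dots,\lambda_{\alpha_k})\in\mathcal H_{k+1}(a_{\gamma_1},\dots,a_{\gamma_k},c)$ and $(c;\lambda_{\beta_1},\dots,\lambda_{\beta_{m-k-1}})\in\mathcal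 H_{m-k}(a_{\delta_1},\dots,a_{\delta_{m-k}})$. A list $\sigma$ is in $\mathcal H_n$ if it can be written as $(\lambda_1;\lambda_2,\dots,\lambda_n)\in\mathcal H_n(a_1,\dots,a_n)$ for some choice of the first entry and some $a_1,\dots,a_n\ge0$. **C-realisability.** A list of length $n$ is *C-realisable* if it can be obtained from $n$ copies of the list $(0)$ by finitely many steps of the following kinds, in any order: replace two lists by their union; replace $(\rho,\lambda_2,\dots,\lambda_m)$, where $\rho$ is its largest (Perron) entry, by $(\rho+\epsilon,\lambda_2,\dots,\lambda_m)$ with $\epsilon\ge0$; replace such a list with $m\ge2$ by $(\rho+\epsilon,\lambda_2\pm\epsilon,\lambda_3,\dots,\lambda_m)$ with $\epsilon\ge0$, where $\lambda_2$ may be any of the non-Perron entries. **Soto's criteria.** For $\lambda_1\ge\dots\ge\lambda_n$ put $T_i=\lambda_i+\lambda_{n-i+1}$ for $2\le i\le\lfloor n/2\rfloor$ and, for odd $n\ge3$, $T_{(n+1)/2}=\min\{\lambda_{(n+1)/2},0\}$. The list satisfies $\mathbb S_1$ if $\lambda_1\ge-\lambda_n-\sum_{T_i<0}T_i$. For a criterion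 $K$ put $\mathcal N_K(\sigma)=\min\{\epsilon\ge0:(\lambda_1+\epsilon,\lambda_2,\dots,\lambda_n)\text{ satisfies }K\}$ and, if $\sigma$ satisfies $K$, $\mathcal M_K(\sigma)=\max\{\epsilon\in[0,\lambda_1-\lambda_2]:(\lambda_1-\epsilon,\lambda_2,\dots,\lambda_n)\text{ satisfies }K\}$ (for $n=1$ the only restriction on $\epsilon$ is $\epsilon\ge0$). For $p\ge2$, $\sigma$ satisfies $\mathbb S_p$ if it can be partitioned into $r\ge1$ nonempty sublists $\sigma_1,\dots,\sigma_r$ whose largest entries $\lambda_1^{(i)}$ are nonnegative, with $\lambda_1^{(1)}=\lambda_1$, such that $\sigma_1$ satisfies $\mathbb S_{p-1}$ and $$\lambda_1\ge\max\{\lambda_1-\mathcal M_{\mathbb S_{p-1}}(\sigma_1),\lambda_1^{(2)},\dots,\lambda_1^{(r)}\}+\sum_{\sigma_i\text{ not satisfying }\mathbb S_{p-1}}\mathcal N_{\mathbb S_{p-1}}(\sigma_i).$$ **Theorem.** Let $\sigma=(\lambda_1;\lambda_2,\dots,\lambda_n)$ be a list of $n\ge1$ real numbers with $\lambda_1=\max_i\lambda_i$.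 The following are equivalent: (i) $\sigma\in\overline{\mathcal S}_n$; (ii) $\sigma\in\mathcal H_n$; (iii) $\sigma$ is C-realisable; (iv) $\sigma$ satisfies $\mathbb S_p$ for some $p\ge1$. Furthermore, if $a_1,\dots,a_n\ge0$ are given, then $(\lambda_1;\lambda_2,\dots,\lambda_n)\in\overline{\mathcal S}_n(a_1,\dots,a_n)$ if and only if $(\lambda_1;\lambda_2,\dots,\lambda_n)\in\mathcal H_n(a_1,\dots,a_n)$. -/

import Mathlib

/-!
Lists of real numbers are unordered, repetitions counting, so they are modelled by `Multiset ℝ`.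
A list `(ρ; τ)` with a distinguished first entry is given by `ρ : ℝ` and `τ : Multiset ℝ`;
splitting the index set of a list into two classes means writing the multiset as a sum.
-/

namespace SNIEP

/-- Soules matrices: orthogonal, with positive first column, such that `R Λ Rᵀ` is entrywise
nonnegative for every `Λ = diag(l₁, …, lₙ)` with `l₁ ≥ ⋯ ≥ lₙ ≥ 0`. -/
def IsSoulesMatrix {n : ℕ} (R : Matrix (Fin n) (Fin n) ℝ) : Prop :=
  R ∈ Matrix.orthogonalGroup (Fin n) ℝ ∧
  (∀ i j : Fin n, (j : ℕ) = 0 → 0 < R i j) ∧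
  ∀ l : Fin n → ℝ, Antitone l → (∀ i, 0 ≤ l i) →
    ∀ i j, 0 ≤ (R * Matrix.diagonal l * R.transpose) i j

/-- `σ ∈ 𝒮ₙ(a)`: with `σ` arranged as `l₁ ≥ ⋯ ≥ lₙ` there is a Soules matrix `R` such that
`R diag(l) Rᵀ` has diagonal elements `a` (in some order), all of them nonnegative. -/
def SoulesWith (σ a : Multiset ℝ) : Prop :=
  ∃ (n : ℕ) (l : Fin n → ℝ) (R : Matrix (Fin n) (Fin n) ℝ),
    0 < n ∧ Antitone l ∧ σ = Finset.univ.val.map l ∧ IsSoulesMatrix R ∧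
    a = Finset.univ.val.map (fun i => (R * Matrix.diagonal l * R.transpose) i i) ∧
    ∀ x ∈ a, 0 ≤ x

/-- `σ ∈ 𝒮̄ₙ(a)`: `σ` and `a` can be partitioned into sublists `σ₁, …, σₖ` and `a₁, …, aₖ` with
`σᵢ ∈ 𝒮(aᵢ)` for every `i`. The members of `s` are the pairs `(σᵢ, aᵢ)`. -/
def SoulesBarWith (σ a : Multiset ℝ) : Prop :=
  ∃ s : Multiset (Multiset ℝ × Multiset ℝ),
    (∀ q ∈ s, SoulesWith q.1 q.2) ∧ σ = (s.map Prod.fst).sum ∧ a = (s.map Prod.snd).sum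

/-- The extended Soules set `𝒮̄ₙ`. -/
def SoulesBar (σ : Multiset ℝ) : Prop :=
  ∃ a : Multiset ℝ, SoulesBarWith σ a

/-- `HWith ρ τ a` says `(ρ; τ) ∈ ℋₘ(a)`, where `m` is the length of `(ρ; τ)` and of `a`. In the
recursive clause `(ρ; α, β) ∈ ℋₘ(γ, δ)` is reduced to two strictly shorter lists. -/
inductive HWith : ℝ → Multiset ℝ → Multiset ℝ → Prop
  | one (a : ℝ) (ha : 0 ≤ a) : HWith a 0 {a}
  | two (x y a b : ℝ) (ha : 0 ≤ a) (hb : 0 ≤ b) (hx : max a b ≤ x) (hxy : x + y = a + b) :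
      HWith x {y} {a, b}
  | step (ρ c : ℝ) (α β γ δ : Multiset ℝ) (hα : α ≠ 0) (hβ : β ≠ 0) (hc : 0 ≤ c)
      (h₁ : HWith ρ α (c ::ₘ γ)) (h₂ : HWith c β δ) : HWith ρ (α + β) (γ + δ)

/-- `σ ∈ ℋₙ`: `σ` can be written as `(ρ; τ)` with `(ρ; τ) ∈ ℋₙ(a)` for some `a`. (Membership forces
`ρ` to be the largest entry.) -/
def InH (σ : Multiset ℝ) : Prop :=
  ∃ (ρ : ℝ) (τ a : Multiset ℝ), σ = ρ ::ₘ τ ∧ HWith ρ τ a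

/-- C-realisability: obtainable from lists `(0)` by unions, by increasing the Perron (that is,
largest) entry, and by increasing the Perron entry by `ε ≥ 0` while changing another entry
by `ε` or by `-ε`. -/
inductive CRealisable : Multiset ℝ → Prop
  | zero : CRealisable {0}
  | union (σ τ : Multiset ℝ) (hσ : CRealisable σ) (hτ : CRealisable τ) : CRealisable (σ + τ)
  | perron (ρ ε : ℝ) (τ : Multiset ℝ) (hρ : ∀ y ∈ τ, y ≤ ρ) (hε : 0 ≤ ε)
      (h : CRealisable (ρ ::ₘ τ)) : CRealisable ((ρ + ε) ::ₘ τ)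
  | guo_add (ρ x ε : ℝ) (τ : Multiset ℝ) (hx : x ≤ ρ) (hρ : ∀ y ∈ τ, y ≤ ρ) (hε : 0 ≤ ε)
      (h : CRealisable (ρ ::ₘ x ::ₘ τ)) : CRealisable ((ρ + ε) ::ₘ (x + ε) ::ₘ τ)
  | guo_sub (ρ x ε : ℝ) (τ : Multiset ℝ) (hx : x ≤ ρ) (hρ : ∀ y ∈ τ, y ≤ ρ) (hε : 0 ≤ ε)
      (h : CRealisable (ρ ::ₘ x ::ₘ τ)) : CRealisable ((ρ + ε) ::ₘ (x - ε) ::ₘ τ)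

/-- The `i`-th largest entry of `σ`, for `1 ≤ i ≤ n` where `n` is the length of `σ`. -/
noncomputable def entry (σ : Multiset ℝ) (i : ℕ) : ℝ :=
  (σ.sort (· ≥ ·)).getD (i - 1) 0

/-- The numbers `Tᵢ`, `2 ≤ i ≤ ⌊(n+1)/2⌋`: they are `λᵢ + λₙ₋ᵢ₊₁`, except that for odd `n` the
middle one is `min (λᵢ) 0`. -/
noncomputable def sotoT (σ : Multiset ℝ) (i : ℕ) : ℝ :=
  if 2 * i = Multiset.card σ + 1 then min (entry σ i) 0
  else entry σ i + entry σ (Multiset.card σ + 1 - i)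

open Classical in
/-- The criterion `𝕊₁`: `λ₁ ≥ -λₙ - ∑_{Tᵢ < 0} Tᵢ`. -/
def SotoOne (σ : Multiset ℝ) : Prop :=
  entry σ 1 ≥ - entry σ (Multiset.card σ)
    - ∑ i ∈ (Finset.Icc 2 ((Multiset.card σ + 1) / 2)).filter (fun i => sotoT σ i < 0), sotoT σ i

/-- The Brauer `K`-negativity of `(ρ; τ)`, where `ρ` is the largest entry: the least `ε ≥ 0` such
that `(ρ + ε; τ)` satisfies `K`. -/
noncomputable def brauerNegativity (K : Multiset ℝ → Prop) (ρ : ℝ) (τ : Multiset ℝ) : ℝ :=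
  sInf {ε : ℝ | 0 ≤ ε ∧ K ((ρ + ε) ::ₘ τ)}

/-- The Brauer `K`-realisability margin of `(ρ; τ)`, where `ρ` is the largest entry: the greatest
`ε ≥ 0` such that `ρ - ε` is still the largest entry of `(ρ - ε; τ)` (no condition if `τ` is
empty) and `(ρ - ε; τ)` satisfies `K`. -/
noncomputable def brauerMargin (K : Multiset ℝ → Prop) (ρ : ℝ) (τ : Multiset ℝ) : ℝ :=
  sSup {ε : ℝ | 0 ≤ ε ∧ (∀ x ∈ τ, ε ≤ ρ - x) ∧ K ((ρ - ε) ::ₘ τ)}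

open Classical in
/-- The step from a criterion `K` to the next one: `σ` is partitioned into `σ₁ = (ρ; τ)`, where `ρ`
is the largest entry of `σ`, and further sublists `σᵢ = (q.1; q.2)`, `q ∈ s`, with largest entries
`q.1`; all largest entries are nonnegative, `σ₁` satisfies `K`, and
`ρ ≥ γ + ∑_{σᵢ not satisfying K} (negativity of σᵢ)` where `γ` is the maximum of `ρ - (margin of σ₁)`
and of all `q.1`. -/
def SotoStep (K : Multiset ℝ → Prop) (σ : Multiset ℝ) : Prop :=
  ∃ (ρ : ℝ) (τ : Multiset ℝ) (s : Multiset (ℝ × Multiset ℝ)),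
    σ = (ρ ::ₘ τ) + (s.map (fun q => q.1 ::ₘ q.2)).sum ∧
    (∀ x ∈ σ, x ≤ ρ) ∧ 0 ≤ ρ ∧
    (∀ q ∈ s, 0 ≤ q.1 ∧ ∀ x ∈ q.2, x ≤ q.1) ∧
    K (ρ ::ₘ τ) ∧
    ρ ≥ (s.map Prod.fst).fold max (ρ - brauerMargin K ρ τ)
      + ((s.filter (fun q => ¬ K (q.1 ::ₘ q.2))).map
          (fun q => brauerNegativity K q.1 q.2)).sum

/-- Soto's criterion `𝕊ₚ` for `p ≥ 1` (the value at `p = 0` is a placeholder). -/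
def SotoCriterion : ℕ → Multiset ℝ → Prop
  | 0 => fun _ => False
  | 1 => SotoOne
  | p + 2 => SotoStep (SotoCriterion (p + 1))

end SNIEP

/-!
Unfolding its recursive clause, `(ρ; τ) ∈ ℋₙ(a)` says that there is a full binary tree
(`SplitTree`) with nonnegative numbers on its nodes, `ρ` at the root and `a` on the leaves, in which
no child exceeds its parent; an inner node with number `x` and children `a`, `b` carries the entry
`a + b - x` of `τ`. The proof manipulates such trees. The key is a rotation
(`SplitTree.rotate`) which exchanges the entries of an inner node and its child whenever the one
above is the smaller. Hence the largest entry of `τ` can be brought to the root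
(`SplitTree.exists_node_of_max`) and the smallest to a node whose two children are leaves
(`SplitTree.exists_bottom_of_min`).

*Soules matrices.* Passing from a Soules matrix of size `n` to one of size `n + 1` with a new
smallest eigenvalue `y` amounts to splitting one diagonal entry `c` into `a` and `b`, where
`a + b = c + y` and `a, b < c` (`IsSoulesMatrix.exists_split`), and every Soules matrix of size at
least two arises in this way, because its last column has only two nonzero entries
(`IsSoulesMatrix.exists_merge`). So a Soules matrix is a tree built in decreasing order of the
entries of `τ`, which by the rotations is no restriction. The splits in which one child equals its
parent account for the passage to unions of lists.

*C-realisability.* A splitting of the root is a union of two lists, followed by raising the larger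
and lowering the smaller of their Perron entries; conversely, a change of the Perron entry and one
further entry is achieved by raising the nodes along a path from the root.

*Soto's criteria.* For fixed `τ` the `ρ` admitting a tree form a closed half-line
(`Feasible.exists_threshold`), so negativities and margins defined by a criterion that implies
feasibility lead to feasible lists, and the inequality in the criteria is what is needed to join
the sublists one after the other (`SotoStep.feasible`). Conversely, bring the largest entry
`y` of `τ` to the root. If `y ≥ 0`, the splitting of the root is a step from one criterion to the
next with two sublists (`SotoStep.of_node`); if `y < 0`, the first criterion reduces to the sum of
the list being nonnegative (`Feasible.sotoOne_of_neg`).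
-/

namespace SNIEP

/-! ### Splitting trees -/

/-- `SplitTree ρ τ A`: there is a full binary tree with nonnegative numbers on its nodes in which
no child exceeds its parent, the root carries `ρ`, the leaves carry `A`, and `τ` collects over the
inner nodes the numbers `a + b - x`, where `x` is the number on the node and `a`, `b` are those on
its children. -/
inductive SplitTree : ℝ → Multiset ℝ → Multiset ℝ → Prop
  | leaf (a : ℝ) (ha : 0 ≤ a) : SplitTree a 0 {a}
  | node (ρ a b : ℝ) (τ₁ τ₂ A₁ A₂ : Multiset ℝ) (ha : a ≤ ρ) (hb : b ≤ ρ)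
      (h₁ : SplitTree a τ₁ A₁) (h₂ : SplitTree b τ₂ A₂) :
      SplitTree ρ ((a + b - ρ) ::ₘ (τ₁ + τ₂)) (A₁ + A₂)

namespace SplitTree

variable {ρ : ℝ} {τ A : Multiset ℝ}

theorem node' {ρ a b y : ℝ} {τ₁ τ₂ A₁ A₂ : Multiset ℝ} (ha : a ≤ ρ) (hb : b ≤ ρ)
    (hy : a + b = ρ + y) (h₁ : SplitTree a τ₁ A₁) (h₂ : SplitTree b τ₂ A₂) :
    SplitTree ρ (y ::ₘ (τ₁ + τ₂)) (A₁ + A₂) := by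
  obtain rfl : y = a + b - ρ := by linarith
  exact node ρ a b τ₁ τ₂ A₁ A₂ ha hb h₁ h₂

theorem root_nonneg (h : SplitTree ρ τ A) : 0 ≤ ρ := by
  induction h with
  | leaf a ha => exact ha
  | node ρ a b τ₁ τ₂ A₁ A₂ ha hb h₁ h₂ ih₁ ih₂ => exact ih₁.trans ha

theorem le_root (h : SplitTree ρ τ A) : ∀ x ∈ τ, x ≤ ρ := by
  induction h with
  | leaf a ha => simp
  | node ρ a b τ₁ τ₂ A₁ A₂ ha hb h₁ h₂ ih₁ ih₂ =>
    intro x hx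
    simp only [Multiset.mem_cons, Multiset.mem_add] at hx
    rcases hx with rfl | hx | hx
    · linarith
    · exact (ih₁ x hx).trans ha
    · exact (ih₂ x hx).trans hb

theorem leaves_nonneg (h : SplitTree ρ τ A) : ∀ x ∈ A, 0 ≤ x := by
  induction h with
  | leaf a ha => simpa using ha
  | node ρ a b τ₁ τ₂ A₁ A₂ ha hb h₁ h₂ ih₁ ih₂ =>
    intro x hx
    exact (Multiset.mem_add.1 hx).elim (ih₁ x) (ih₂ x)

theorem sum_eq (h : SplitTree ρ τ A) : ρ + τ.sum = A.sum := by
  induction h with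
  | leaf a ha => simp
  | node ρ a b τ₁ τ₂ A₁ A₂ ha hb h₁ h₂ ih₁ ih₂ =>
    simp only [Multiset.sum_cons, Multiset.sum_add]
    linarith

theorem leaves_of_eq_zero (h : SplitTree ρ τ A) (hτ : τ = 0) : A = {ρ} := by
  cases h with
  | leaf a ha => rfl
  | node => simp at hτ

/-- Grafting a tree onto a leaf. -/
theorem graft {c : ℝ} {β δ : Multiset ℝ} (h : SplitTree ρ τ A) (h' : SplitTree c β δ) :
    ∀ γ, A = c ::ₘ γ → SplitTree ρ (τ + β) (γ + δ) := by
  induction h with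
  | leaf a ha =>
    intro γ hγ
    obtain ⟨rfl, rfl⟩ : a = c ∧ γ = 0 := by
      have := (Multiset.singleton_eq_cons_iff (a := a) (b := c) (m := γ)).1 hγ
      exact ⟨this.1, this.2⟩
    simpa using h'
  | node ρ a b τ₁ τ₂ A₁ A₂ ha hb h₁ h₂ ih₁ ih₂ =>
    intro γ hγ
    have hc : c ∈ A₁ + A₂ := hγ ▸ Multiset.mem_cons_self c γ
    rcases Multiset.mem_add.1 hc with hc | hc
    · obtain ⟨γ₁, rfl⟩ := Multiset.exists_cons_of_mem hc
      obtain rfl : γ₁ + A₂ = γ := by simpa using hγ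
      have := node ρ a b _ _ _ _ ha hb (ih₁ γ₁ rfl) h₂
      convert this using 1
      · simp only [Multiset.cons_add]; congr 1; abel
      · abel
    · obtain ⟨γ₂, rfl⟩ := Multiset.exists_cons_of_mem hc
      obtain rfl : A₁ + γ₂ = γ := by simpa using hγ
      have := node ρ a b _ _ _ _ ha hb h₁ (ih₂ γ₂ rfl)
      convert this using 1
      · simp only [Multiset.cons_add]; congr 1; abel
      · abel

theorem of_hWith (h : HWith ρ τ A) : SplitTree ρ τ A := by
  induction h with
  | one a ha => exact leaf a ha
  | two x y a b ha hb hx hxy =>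
    exact node' ((le_max_left _ _).trans hx) ((le_max_right _ _).trans hx) hxy.symm
      (leaf a ha) (leaf b hb)
  | step ρ c α β γ δ hα hβ hc h₁ h₂ ih₁ ih₂ => exact graft ih₁ ih₂ γ rfl

theorem hWith (h : SplitTree ρ τ A) : HWith ρ τ A := by
  induction h with
  | leaf a ha => exact .one a ha
  | node ρ a b τ₁ τ₂ A₁ A₂ ha hb h₁ h₂ ih₁ ih₂ =>
    have key : HWith ρ {a + b - ρ} {a, b} :=
      .two _ _ _ _ h₁.root_nonneg h₂.root_nonneg (max_le ha hb) (by ring)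
    have key₁ : HWith ρ ({a + b - ρ} + τ₁) (b ::ₘ A₁) := by
      by_cases h0 : τ₁ = 0
      · rw [h₁.leaves_of_eq_zero h0, h0, add_zero]
        have hpair : b ::ₘ ({a} : Multiset ℝ) = {a, b} := Multiset.pair_comm b a
        rw [hpair]
        exact key
      · exact .step ρ a _ _ {b} _ (by simp) h0 h₁.root_nonneg key ih₁
    by_cases h0 : τ₂ = 0
    · rw [h₂.leaves_of_eq_zero h0, h0, add_zero, add_comm A₁]
      exact key₁
    · have := HWith.step ρ b _ _ _ _ (by simp) h0 h₂.root_nonneg key₁ ih₂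
      rwa [add_assoc, Multiset.singleton_add] at this

theorem iff_hWith : SplitTree ρ τ A ↔ HWith ρ τ A := ⟨hWith, of_hWith⟩

theorem raise_root (h : SplitTree ρ τ A) {ε : ℝ} (hε : 0 ≤ ε) :
    ∃ B, SplitTree (ρ + ε) τ B := by
  induction h with
  | leaf a ha => exact ⟨_, leaf (a + ε) (by linarith)⟩
  | node ρ a b τ₁ τ₂ A₁ A₂ ha hb h₁ h₂ ih₁ ih₂ =>
    obtain ⟨B, hB⟩ := ih₁
    exact ⟨_, node' (by linarith) (by linarith) (by ring) hB h₂⟩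

/-- A tree with root `ρ → (a, b)` whose child splits as `a → (a₁, a₂)` can be rotated into
`ρ → (ρ + a₁ - a, a₂)`, `ρ + a₁ - a → (a₁, b)`. This exchanges the numbers `a + b - ρ` and
`y = a₁ + a₂ - a` belonging to the two inner nodes, and is possible if `a + b - ρ ≤ y`. -/
theorem rotate {ρ a b a₁ a₂ y : ℝ} {τ₁ τ₃ A₁ A₃ : Multiset ℝ} (ha : a ≤ ρ)
    (ha₁ : a₁ ≤ a) (ha₂ : a₂ ≤ a) (hy : a₁ + a₂ = a + y) (hle : a + b - ρ ≤ y)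
    (h₁ : SplitTree a₁ τ₁ A₁) (h₃ : SplitTree b τ₃ A₃) :
    ∃ d, SplitTree d ((a + b - ρ) ::ₘ (τ₁ + τ₃)) (A₁ + A₃) ∧ d ≤ ρ ∧ a₂ ≤ ρ ∧
      d + a₂ = ρ + y :=
  ⟨ρ + a₁ - a, node' (by linarith) (by linarith) (by ring) h₁ h₃, by linarith, by linarith,
    by linarith⟩

/-- The tree can be rearranged so that the root carries the largest element of `τ`. -/
theorem exists_node_of_max (h : SplitTree ρ τ A) : ∀ y ∈ τ, (∀ x ∈ τ, x ≤ y) →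
    ∃ (a b : ℝ) (τ₁ τ₂ A₁ A₂ : Multiset ℝ), SplitTree a τ₁ A₁ ∧ SplitTree b τ₂ A₂ ∧
      a ≤ ρ ∧ b ≤ ρ ∧ a + b = ρ + y ∧ τ = y ::ₘ (τ₁ + τ₂) ∧ A = A₁ + A₂ := by
  induction h with
  | leaf a ha => simp
  | node ρ a b τ₁ τ₂ A₁ A₂ ha hb h₁ h₂ ih₁ ih₂ =>
    intro y hy hmax
    have hle : a + b - ρ ≤ y := hmax _ (Multiset.mem_cons_self _ _)
    simp only [Multiset.mem_cons, Multiset.mem_add] at hy hmax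
    rcases hy with rfl | hy | hy
    · exact ⟨a, b, τ₁, τ₂, A₁, A₂, h₁, h₂, ha, hb, by ring, rfl, rfl⟩
    · obtain ⟨a₁, a₂, σ₁, σ₂, B₁, B₂, k₁, k₂, l₁, l₂, e, rfl, rfl⟩ :=
        ih₁ y hy fun x hx => hmax x (.inr (.inl hx))
      obtain ⟨d, hd, hdρ, haρ, hs⟩ :=
        rotate ha l₁ l₂ e hle k₁ h₂
      refine ⟨d, a₂, _, σ₂, _, B₂, hd, k₂, hdρ, haρ, hs, ?_, by abel⟩
      simp only [Multiset.cons_add]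
      rw [Multiset.cons_swap]
      congr 2; abel
    · obtain ⟨a₁, a₂, σ₁, σ₂, B₁, B₂, k₁, k₂, l₁, l₂, e, rfl, rfl⟩ :=
        ih₂ y hy fun x hx => hmax x (.inr (.inr hx))
      rw [add_comm a b] at hle
      obtain ⟨d, hd, hdρ, haρ, hs⟩ :=
        rotate hb l₁ l₂ e hle k₁ h₁
      refine ⟨d, a₂, _, σ₂, _, B₂, hd, k₂, hdρ, haρ, hs, ?_, by abel⟩
      simp only [Multiset.cons_add, Multiset.add_cons]
      rw [Multiset.cons_swap, add_comm a b]
      congr 2; abel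

/-- The tree can be rearranged so that the smallest element of `τ` belongs to a node both of whose
children are leaves: bring the largest element to the root and descend. -/
theorem exists_bottom_of_min : ∀ (n : ℕ) {ρ : ℝ} {τ A : Multiset ℝ}, Multiset.card τ = n →
    SplitTree ρ τ A → ∀ y ∈ τ, (∀ x ∈ τ, y ≤ x) →
    ∃ (τ' A' : Multiset ℝ) (c a b : ℝ), τ = y ::ₘ τ' ∧ A = a ::ₘ b ::ₘ A' ∧
      SplitTree ρ τ' (c ::ₘ A') ∧ 0 ≤ a ∧ 0 ≤ b ∧ a ≤ c ∧ b ≤ c ∧ a + b = c + y := by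
  intro n
  induction n using Nat.strong_induction_on with
  | _ n ih =>
  intro ρ τ A hn h y hy hmin
  obtain ⟨z, hz, hmax⟩ : ∃ z ∈ τ, ∀ x ∈ τ, x ≤ z :=
    Multiset.exists_max_image id (by rintro rfl; simp at hy)
  obtain ⟨a, b, τ₁, τ₂, A₁, A₂, h₁, h₂, ha, hb, e, rfl, rfl⟩ := h.exists_node_of_max z hz hmax
  by_cases h0 : τ₁ + τ₂ = 0
  · obtain ⟨rfl, rfl⟩ : τ₁ = 0 ∧ τ₂ = 0 := by simpa using h0
    obtain rfl : y = z := by simpa using hy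
    rw [h₁.leaves_of_eq_zero rfl, h₂.leaves_of_eq_zero rfl]
    exact ⟨0, 0, ρ, a, b, by simp, rfl, leaf ρ h.root_nonneg, h₁.root_nonneg, h₂.root_nonneg,
      ha, hb, e⟩
  have hy' : y ∈ τ₁ + τ₂ := by
    rcases Multiset.mem_cons.1 hy with rfl | hy'
    · obtain ⟨w, hw⟩ := Multiset.exists_mem_of_ne_zero h0
      have hw' : w ∈ y ::ₘ (τ₁ + τ₂) := Multiset.mem_cons_of_mem hw
      rwa [← (hmax w hw').antisymm (hmin w hw')]
    · exact hy'
  simp only [Multiset.card_cons, Multiset.card_add] at hn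
  simp only [Multiset.mem_cons, Multiset.mem_add] at hmin
  rcases Multiset.mem_add.1 hy' with hy' | hy'
  · obtain ⟨τ', A', c, p, q, rfl, rfl, k, hp, hq, hpc, hqc, e'⟩ :=
      ih _ (by omega) rfl h₁ y hy' fun x hx => hmin x (.inr (.inl hx))
    refine ⟨z ::ₘ (τ' + τ₂), A' + A₂, c, p, q, ?_, by simp, ?_, hp, hq, hpc, hqc, e'⟩
    · rw [Multiset.cons_add, Multiset.cons_swap]
    · rw [← Multiset.cons_add c]
      exact node' ha hb e k h₂
  · obtain ⟨τ', A', c, p, q, rfl, rfl, k, hp, hq, hpc, hqc, e'⟩ :=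
      ih _ (by omega) rfl h₂ y hy' fun x hx => hmin x (.inr (.inr hx))
    refine ⟨z ::ₘ (τ₁ + τ'), A₁ + A', c, p, q, ?_, by simp, ?_, hp, hq, hpc, hqc, e'⟩
    · rw [Multiset.add_cons, Multiset.cons_swap]
    · rw [← Multiset.add_cons c]
      exact node' ha hb e h₁ k

/-- Two trees are joined under the larger of the two roots; the smaller root joins `τ`. -/
theorem join {ρ₁ ρ₂ : ℝ} {τ₁ τ₂ A₁ A₂ : Multiset ℝ} (h₁ : SplitTree ρ₁ τ₁ A₁)
    (h₂ : SplitTree ρ₂ τ₂ A₂) (hle : ρ₂ ≤ ρ₁) :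
    SplitTree ρ₁ (ρ₂ ::ₘ (τ₁ + τ₂)) (A₁ + A₂) :=
  node' le_rfl hle rfl h₁ h₂

end SplitTree

/-- If `ρ` and `ρ'` are the largest entries of the same list, the remaining entries agree. -/
theorem eq_of_cons_eq_cons_of_max {ρ ρ' : ℝ} {τ τ' : Multiset ℝ} (h : ρ ::ₘ τ = ρ' ::ₘ τ')
    (hρ : ∀ x ∈ τ, x ≤ ρ) (hρ' : ∀ x ∈ τ', x ≤ ρ') : ρ = ρ' ∧ τ = τ' := by
  have h₁ : ρ ≤ ρ' := by
    rcases Multiset.mem_cons.1 (h ▸ Multiset.mem_cons_self ρ τ) with h | h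
    exacts [h.le, hρ' _ h]
  have h₂ : ρ' ≤ ρ := by
    rcases Multiset.mem_cons.1 (h ▸ Multiset.mem_cons_self ρ' τ') with h | h
    exacts [h.le, hρ _ h]
  obtain rfl := h₁.antisymm h₂
  exact ⟨rfl, (Multiset.cons_inj_right ρ).1 h⟩

/-- `Feasible ρ τ` says `(ρ; τ) ∈ ℋ` for some choice of diagonal entries. -/
def Feasible (ρ : ℝ) (τ : Multiset ℝ) : Prop :=
  ∃ A, SplitTree ρ τ A

theorem inH_cons_iff {ρ : ℝ} {τ : Multiset ℝ} (hρ : ∀ x ∈ τ, x ≤ ρ) :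
    InH (ρ ::ₘ τ) ↔ Feasible ρ τ := by
  constructor
  · rintro ⟨ρ', τ', A, h, hA⟩
    have hA := SplitTree.of_hWith hA
    obtain ⟨rfl, rfl⟩ := eq_of_cons_eq_cons_of_max h hρ hA.le_root
    exact ⟨A, hA⟩
  · rintro ⟨A, hA⟩
    exact ⟨ρ, τ, A, rfl, hA.hWith⟩

namespace Feasible

variable {ρ ρ' : ℝ} {τ τ' : Multiset ℝ}

theorem mono (h : Feasible ρ τ) (hle : ρ ≤ ρ') : Feasible ρ' τ := by
  obtain ⟨A, hA⟩ := h
  have := hA.raise_root (sub_nonneg.2 hle)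
  rwa [add_sub_cancel] at this

theorem le_root (h : Feasible ρ τ) : ∀ x ∈ τ, x ≤ ρ := h.elim fun _ hA => hA.le_root

theorem nonneg (h : Feasible ρ τ) : 0 ≤ ρ := h.elim fun _ hA => hA.root_nonneg

theorem leaf (h : 0 ≤ ρ) : Feasible ρ 0 := ⟨_, .leaf ρ h⟩

theorem node {ρ a b y : ℝ} {τ₁ τ₂ : Multiset ℝ} (ha : a ≤ ρ) (hb : b ≤ ρ) (hy : a + b = ρ + y)
    (h₁ : Feasible a τ₁) (h₂ : Feasible b τ₂) : Feasible ρ (y ::ₘ (τ₁ + τ₂)) := by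
  obtain ⟨A₁, h₁⟩ := h₁
  obtain ⟨A₂, h₂⟩ := h₂
  exact ⟨_, .node' ha hb hy h₁ h₂⟩

/-- The admissible roots for given `τ` form a closed half-line: the smallest admissible root is the
minimum, over the finitely many ways to write `τ = (y; τ₁, τ₂)`, of `max m₁ y + max m₂ y - y`, where
`mᵢ` is the smallest admissible root for `τᵢ`. -/
theorem exists_threshold : ∀ (n : ℕ) (τ : Multiset ℝ), Multiset.card τ = n →
    ∃ m : ℝ, ∀ ρ, Feasible ρ τ ↔ m ≤ ρ := by
  intro n
  induction n using Nat.strong_induction_on with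
  | _ n ih =>
  rintro τ rfl
  rcases eq_or_ne τ 0 with rfl | hτ
  · exact ⟨0, fun ρ => ⟨fun h => h.nonneg, leaf⟩⟩
  have ih' : ∀ σ : Multiset ℝ, Multiset.card σ < Multiset.card τ →
      ∃ m : ℝ, ∀ ρ, Feasible ρ σ ↔ m ≤ ρ := fun σ hσ => ih _ hσ σ rfl
  choose! m hm using ih'
  let F : Finset (ℝ × Multiset ℝ × Multiset ℝ) :=
    (τ.toFinset ×ˢ τ.powerset.toFinset ×ˢ τ.powerset.toFinset).filter
      fun t => τ = t.1 ::ₘ (t.2.1 + t.2.2)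
  have hF : ∀ t, t ∈ F ↔ τ = t.1 ::ₘ (t.2.1 + t.2.2) := by
    rintro ⟨y, τ₁, τ₂⟩
    simp only [F, Finset.mem_filter, Finset.mem_product, Multiset.mem_toFinset,
      Multiset.mem_powerset, and_iff_right_iff_imp]
    rintro rfl
    exact ⟨Multiset.mem_cons_self _ _,
      (Multiset.le_add_right _ _).trans (Multiset.le_cons_self _ _),
      (Multiset.le_add_left _ _).trans (Multiset.le_cons_self _ _)⟩
  let g : ℝ × Multiset ℝ × Multiset ℝ → ℝ :=
    fun t => max (m t.2.1) t.1 + max (m t.2.2) t.1 - t.1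
  have hg : ∀ ρ, Feasible ρ τ ↔ ∃ t ∈ F, g t ≤ ρ := by
    intro ρ
    constructor
    · rintro ⟨A, h⟩
      cases h with
      | leaf => exact absurd rfl hτ
      | node _ a b τ₁ τ₂ A₁ A₂ ha hb h₁ h₂ =>
        refine ⟨(a + b - ρ, τ₁, τ₂), (hF _).2 rfl, ?_⟩
        have e₁ := (hm τ₁ (by simp) a).1 ⟨_, h₁⟩
        have e₂ := (hm τ₂ (by simp) b).1 ⟨_, h₂⟩
        have e₃ : max (m τ₁) (a + b - ρ) ≤ a := max_le e₁ (by linarith)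
        have e₄ : max (m τ₂) (a + b - ρ) ≤ b := max_le e₂ (by linarith)
        change max (m τ₁) (a + b - ρ) + max (m τ₂) (a + b - ρ) - (a + b - ρ) ≤ ρ
        linarith
    · rintro ⟨⟨y, τ₁, τ₂⟩, ht, hle⟩
      obtain rfl := (hF _).1 ht
      refine mono ?_ hle
      change Feasible (max (m τ₁) y + max (m τ₂) y - y) (y ::ₘ (τ₁ + τ₂))
      refine node (a := max (m τ₁) y) (b := max (m τ₂) y) ?_ ?_ (by ring)
        ((hm τ₁ (by simp) _).2 (le_max_left _ _))
        ((hm τ₂ (by simp) _).2 (le_max_left _ _))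
      · linarith [le_max_right (m τ₂) y]
      · linarith [le_max_right (m τ₁) y]
  have hne : F.Nonempty := by
    obtain ⟨y, hy⟩ := Multiset.exists_mem_of_ne_zero hτ
    obtain ⟨σ, rfl⟩ := Multiset.exists_cons_of_mem hy
    exact ⟨(y, σ, 0), (hF _).2 (by simp)⟩
  obtain ⟨t, ht, hmin⟩ := F.exists_min_image g hne
  exact ⟨g t, fun ρ => (hg ρ).trans
    ⟨fun ⟨u, hu, hle⟩ => (hmin u hu).trans hle, fun h => ⟨t, ht, h⟩⟩⟩

/-! ### C-realisability -/

/-- Raising the root by `ε` and lowering one entry of `τ` by `ε`: raise all nodes on the path from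
the root to the inner node to which the entry belongs. -/
theorem guo_sub {ε : ℝ} (hε : 0 ≤ ε) (h : Feasible ρ τ) :
    ∀ x τ', τ = x ::ₘ τ' → Feasible (ρ + ε) ((x - ε) ::ₘ τ') := by
  obtain ⟨A, h⟩ := h
  induction h with
  | leaf a ha => simp
  | node ρ a b τ₁ τ₂ A₁ A₂ ha hb h₁ h₂ ih₁ ih₂ =>
    intro x τ' e
    have hx : x ∈ (a + b - ρ) ::ₘ (τ₁ + τ₂) := e ▸ Multiset.mem_cons_self _ _
    simp only [Multiset.mem_cons, Multiset.mem_add] at hx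
    rcases hx with rfl | hx | hx
    · obtain rfl := (Multiset.cons_inj_right _).1 e
      exact node (by linarith) (by linarith) (by ring) ⟨_, h₁⟩ ⟨_, h₂⟩
    · obtain ⟨σ, rfl⟩ := Multiset.exists_cons_of_mem hx
      rw [Multiset.cons_add, Multiset.cons_swap, Multiset.cons_inj_right] at e
      rw [← e, Multiset.cons_swap, ← Multiset.cons_add]
      exact node (by linarith) (by linarith) (by ring) (ih₁ x σ rfl) ⟨_, h₂⟩
    · obtain ⟨σ, rfl⟩ := Multiset.exists_cons_of_mem hx
      rw [Multiset.add_cons, Multiset.cons_swap, Multiset.cons_inj_right] at e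
      rw [← e, Multiset.cons_swap, ← Multiset.add_cons]
      exact node (by linarith) (by linarith) (by ring) ⟨_, h₁⟩ (ih₂ x σ rfl)

/-- Raising the root and one entry of `τ` by `ε`: raise all nodes on the path from the root to the
inner node to which the entry belongs, and both children of that node. -/
theorem guo_add {ε : ℝ} (hε : 0 ≤ ε) (h : Feasible ρ τ) :
    ∀ x τ', τ = x ::ₘ τ' → Feasible (ρ + ε) ((x + ε) ::ₘ τ') := by
  obtain ⟨A, h⟩ := h
  induction h with
  | leaf a ha => simp
  | node ρ a b τ₁ τ₂ A₁ A₂ ha hb h₁ h₂ ih₁ ih₂ =>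
    intro x τ' e
    have hx : x ∈ (a + b - ρ) ::ₘ (τ₁ + τ₂) := e ▸ Multiset.mem_cons_self _ _
    simp only [Multiset.mem_cons, Multiset.mem_add] at hx
    rcases hx with rfl | hx | hx
    · obtain rfl := (Multiset.cons_inj_right _).1 e
      exact node (a := a + ε) (b := b + ε) (by linarith) (by linarith) (by ring)
        (h₁.raise_root hε) (h₂.raise_root hε)
    · obtain ⟨σ, rfl⟩ := Multiset.exists_cons_of_mem hx
      rw [Multiset.cons_add, Multiset.cons_swap, Multiset.cons_inj_right] at e
      rw [← e, Multiset.cons_swap, ← Multiset.cons_add]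
      exact node (by linarith) (by linarith) (by ring) (ih₁ x σ rfl) ⟨_, h₂⟩
    · obtain ⟨σ, rfl⟩ := Multiset.exists_cons_of_mem hx
      rw [Multiset.add_cons, Multiset.cons_swap, Multiset.cons_inj_right] at e
      rw [← e, Multiset.cons_swap, ← Multiset.add_cons]
      exact node (by linarith) (by linarith) (by ring) ⟨_, h₁⟩ (ih₂ x σ rfl)

/-- A splitting `ρ → (a, b)` with `b ≤ a` is the union of `(a; τ₁)` and `(b; τ₂)`, followed by
raising `a` to `ρ` and lowering `b` by `ρ - a`. -/
theorem cRealisable (h : Feasible ρ τ) : CRealisable (ρ ::ₘ τ) := by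
  have key : ∀ {ρ a b : ℝ} {τ₁ τ₂ : Multiset ℝ}, a ≤ ρ → b ≤ a → (∀ x ∈ τ₁, x ≤ a) →
      (∀ x ∈ τ₂, x ≤ b) → CRealisable (a ::ₘ τ₁) → CRealisable (b ::ₘ τ₂) →
      CRealisable (ρ ::ₘ (a + b - ρ) ::ₘ (τ₁ + τ₂)) := by
    intro ρ a b τ₁ τ₂ ha hb k₁ k₂ c₁ c₂
    have := CRealisable.union _ _ c₁ c₂
    rw [Multiset.cons_add, Multiset.add_cons] at this
    have := CRealisable.guo_sub a b (ρ - a) _ hb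
      (fun x hx => (Multiset.mem_add.1 hx).elim (k₁ x) fun hx => (k₂ x hx).trans hb)
      (sub_nonneg.2 ha) this
    rwa [add_sub_cancel, show b - (ρ - a) = a + b - ρ by ring] at this
  obtain ⟨A, h⟩ := h
  induction h with
  | leaf a ha =>
    have := CRealisable.perron 0 a 0 (by simp) ha .zero
    rwa [zero_add] at this
  | node ρ a b τ₁ τ₂ A₁ A₂ ha hb h₁ h₂ ih₁ ih₂ =>
    rcases le_total b a with hba | hab
    · exact key ha hba h₁.le_root h₂.le_root ih₁ ih₂
    · rw [add_comm a b, add_comm τ₁]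
      exact key hb hab h₂.le_root h₁.le_root ih₂ ih₁

end Feasible

theorem CRealisable.inH {σ : Multiset ℝ} (h : CRealisable σ) : InH σ := by
  induction h with
  | zero => exact ⟨0, 0, {0}, rfl, .one 0 le_rfl⟩
  | union σ τ hσ hτ ih₁ ih₂ =>
    obtain ⟨ρ₁, τ₁, A₁, rfl, h₁⟩ := ih₁
    obtain ⟨ρ₂, τ₂, A₂, rfl, h₂⟩ := ih₂
    rcases le_total ρ₂ ρ₁ with hle | hle
    · refine ⟨ρ₁, ρ₂ ::ₘ (τ₁ + τ₂), _, by simp [Multiset.cons_swap],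
        (SplitTree.join (.of_hWith h₁) (.of_hWith h₂) hle).hWith⟩
    · refine ⟨ρ₂, ρ₁ ::ₘ (τ₂ + τ₁), _, ?_,
        (SplitTree.join (.of_hWith h₂) (.of_hWith h₁) hle).hWith⟩
      rw [add_comm]; simp [Multiset.cons_swap]
  | perron ρ ε τ hρ hε h ih =>
    obtain ⟨A, hA⟩ := (inH_cons_iff hρ).1 ih
    obtain ⟨B, hB⟩ := hA.raise_root hε
    exact ⟨_, _, B, rfl, hB.hWith⟩
  | guo_add ρ x ε τ hx hρ hε h ih =>
    obtain ⟨B, hB⟩ := ((inH_cons_iff (by simpa using ⟨hx, hρ⟩)).1 ih).guo_add hε x τ rfl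
    exact ⟨_, _, B, rfl, hB.hWith⟩
  | guo_sub ρ x ε τ hx hρ hε h ih =>
    obtain ⟨B, hB⟩ := ((inH_cons_iff (by simpa using ⟨hx, hρ⟩)).1 ih).guo_sub hε x τ rfl
    exact ⟨_, _, B, rfl, hB.hWith⟩

/-! ### Soules matrices -/

section Soules

open Finset

theorem mul_diagonal_mul_transpose_apply {n : ℕ} (R : Matrix (Fin n) (Fin n) ℝ) (l : Fin n → ℝ)
    (i j : Fin n) :
    (R * Matrix.diagonal l * R.transpose) i j = ∑ k, R i k * l k * R j k := by
  rw [Matrix.mul_apply]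
  simp only [Matrix.mul_diagonal, Matrix.transpose_apply]

theorem mem_orthogonalGroup_iff_rows {n : ℕ} {R : Matrix (Fin n) (Fin n) ℝ} :
    R ∈ Matrix.orthogonalGroup (Fin n) ℝ ↔
      ∀ i j, ∑ k, R i k * R j k = if i = j then 1 else 0 := by
  rw [Matrix.mem_orthogonalGroup_iff, ← Matrix.ext_iff]
  simp [Matrix.mul_apply, Matrix.one_apply]

theorem mem_orthogonalGroup_iff_columns {n : ℕ} {R : Matrix (Fin n) (Fin n) ℝ} :
    R ∈ Matrix.orthogonalGroup (Fin n) ℝ ↔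
      ∀ i j, ∑ k, R k i * R k j = if i = j then 1 else 0 := by
  rw [Matrix.mem_orthogonalGroup_iff', ← Matrix.ext_iff]
  simp [Matrix.mul_apply, Matrix.one_apply]

theorem map_univ_castSucc {α : Type*} {n : ℕ} (g : Fin (n + 1) → α) :
    univ.val.map g = g (Fin.last n) ::ₘ univ.val.map fun i : Fin n => g i.castSucc := by
  rw [Fin.univ_castSuccEmb]
  simp [Function.comp_def]

theorem map_univ_succAbove {α : Type*} {n : ℕ} (g : Fin (n + 1) → α) (p : Fin (n + 1)) :
    univ.val.map g = g p ::ₘ univ.val.map fun i : Fin n => g (p.succAbove i) := by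
  rw [Fin.univ_succAbove n p]
  simp [Function.comp_def]

theorem map_univ_erase {α : Type*} {n : ℕ} (g : Fin n → α) (p : Fin n) :
    univ.val.map g = g p ::ₘ (univ.erase p).val.map g := by
  rw [← Multiset.map_cons, ← Finset.insert_val_of_notMem (Finset.notMem_erase p univ),
    Finset.insert_erase (mem_univ p)]

theorem map_erase_congr {α : Type*} {n : ℕ} {g g' : Fin n → α} {p : Fin n}
    (h : ∀ i, i ≠ p → g i = g' i) : (univ.erase p).val.map g = (univ.erase p).val.map g' :=
  Multiset.map_congr rfl fun i hi => h i (Finset.ne_of_mem_erase (s := univ) hi)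

theorem antitone_snoc {n : ℕ} {l : Fin n → ℝ} {y : ℝ} (hl : Antitone l) (hy : ∀ k, y ≤ l k) :
    Antitone (Fin.snoc (α := fun _ => ℝ) l y) := by
  intro i j hij
  induction j using Fin.lastCases with
  | last =>
    induction i using Fin.lastCases with
    | last => exact le_rfl
    | cast i => simpa using hy i
  | cast j =>
    induction i using Fin.lastCases with
    | last => exact absurd hij (Fin.castSucc_lt_last j).not_ge
    | cast i => simpa using hl (Fin.castSucc_le_castSucc_iff.1 hij)

/-- A diagonal entry of `R diag(l) Rᵀ` is a convex combination of the `l k`. -/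
theorem le_diag_of_le {n : ℕ} {R : Matrix (Fin n) (Fin n) ℝ}
    (hR : R ∈ Matrix.orthogonalGroup (Fin n) ℝ) {l : Fin n → ℝ} {y : ℝ} (hy : ∀ k, y ≤ l k)
    (i : Fin n) : y ≤ ∑ k, R i k * l k * R i k := by
  have h1 := mem_orthogonalGroup_iff_rows.1 hR i i
  rw [if_pos rfl] at h1
  calc y = ∑ k, R i k * y * R i k := by
        have h2 : ∑ k, R i k * y * R i k = y * ∑ k, R i k * R i k := by
          rw [Finset.mul_sum]
          exact Finset.sum_congr rfl fun k _ => by ring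
        rw [h2, h1, mul_one]
    _ ≤ _ := Finset.sum_le_sum fun k _ => by nlinarith [hy k, mul_self_nonneg (R i k)]

/-- Splitting one row of a Soules matrix in the ratio `p : q` and adding a column supported on the
two new rows gives a Soules matrix of size one larger. -/
theorem IsSoulesMatrix.exists_split {n : ℕ} (hn : 0 < n) {R : Matrix (Fin n) (Fin n) ℝ}
    (hR : IsSoulesMatrix R) (i₀ : Fin n) {p q : ℝ} (hp : 0 < p) (hq : 0 < q)
    (hpq : p * p + q * q = 1) :
    ∃ R' : Matrix (Fin (n + 1)) (Fin (n + 1)) ℝ, IsSoulesMatrix R' ∧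
      ∀ (l : Fin n → ℝ) (y : ℝ), ∃ g : Fin (n + 1) → ℝ,
        (∀ i, (R' * Matrix.diagonal (Fin.snoc (α := fun _ => ℝ) l y) * R'.transpose) i i = g i) ∧
        (∀ i : Fin n, i ≠ i₀ → g i.castSucc = (R * Matrix.diagonal l * R.transpose) i i) ∧
        g i₀.castSucc = p * p * (R * Matrix.diagonal l * R.transpose) i₀ i₀ + q * q * y ∧
        g (Fin.last n) = q * q * (R * Matrix.diagonal l * R.transpose) i₀ i₀ + p * p * y := by
  obtain ⟨hO, hpos, hnn⟩ := hR
  have hrow := mem_orthogonalGroup_iff_rows.1 hO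
  let f : Fin (n + 1) → Fin n := Fin.snoc (α := fun _ => Fin n) id i₀
  let w : Fin (n + 1) → ℝ := Fin.snoc (α := fun _ => ℝ) (fun i => if i = i₀ then p else 1) q
  let v : Fin (n + 1) → ℝ := Fin.snoc (α := fun _ => ℝ) (fun i => if i = i₀ then -q else 0) p
  let R' : Matrix (Fin (n + 1)) (Fin (n + 1)) ℝ :=
    fun i => Fin.snoc (α := fun _ => ℝ) (fun k => w i * R (f i) k) (v i)
  have hw : ∀ i, 0 < w i := by
    intro i
    induction i using Fin.lastCases with
    | last => simpa [w] using hq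
    | cast i =>
      simp only [w, Fin.snoc_castSucc]
      split_ifs
      exacts [hp, one_pos]
  have hsum : ∀ (L : Fin (n + 1) → ℝ) (i j : Fin (n + 1)), ∑ k, R' i k * L k * R' j k =
      w i * w j * ∑ k, R (f i) k * L k.castSucc * R (f j) k + v i * v j * L (Fin.last n) := by
    intro L i j
    rw [Fin.sum_univ_castSucc, Finset.mul_sum]
    simp only [R', Fin.snoc_castSucc, Fin.snoc_last]
    congr 1
    · exact Finset.sum_congr rfl fun k _ => by ring
    · ring
  have hfc : ∀ i : Fin n, f i.castSucc = i := fun i => by simp [f]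
  have hfl : f (Fin.last n) = i₀ := by simp [f]
  have hwl : w (Fin.last n) = q := by simp [w]
  have hvl : v (Fin.last n) = p := by simp [v]
  have hw0 : w i₀.castSucc = p := by simp [w]
  have hv0 : v i₀.castSucc = -q := by simp [v]
  have hwc : ∀ i, i ≠ i₀ → w i.castSucc = 1 := fun i hi => by simp [w, hi]
  have hvc : ∀ i, i ≠ i₀ → v i.castSucc = 0 := fun i hi => by simp [v, hi]
  refine ⟨R', ⟨?_, ?_, ?_⟩, ?_⟩
  · rw [mem_orthogonalGroup_iff_rows]
    intro i j
    have h1 : ∑ k, R' i k * R' j k = w i * w j * (if f i = f j then 1 else 0) + v i * v j := by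
      have := hsum (fun _ => 1) i j
      simp only [mul_one] at this
      rw [this, hrow]
    rw [h1]
    induction i using Fin.lastCases with
    | last =>
      induction j using Fin.lastCases with
      | last => simp only [hfl, hwl, hvl, if_true]; linarith
      | cast j =>
        rw [if_neg (Fin.castSucc_lt_last j).ne', hfl, hwl, hvl, hfc]
        by_cases hj : j = i₀
        · subst hj; rw [if_pos rfl, hw0, hv0]; ring
        · rw [if_neg (Ne.symm hj), hvc j hj]; ring
    | cast i =>
      induction j using Fin.lastCases with
      | last =>
        rw [if_neg (Fin.castSucc_lt_last i).ne, hfl, hwl, hvl, hfc]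
        by_cases hi : i = i₀
        · subst hi; rw [if_pos rfl, hw0, hv0]; ring
        · rw [if_neg hi, hvc i hi]; ring
      | cast j =>
        simp only [hfc, Fin.castSucc_inj]
        by_cases hij : i = j
        · subst hij
          rw [if_pos rfl]
          by_cases hi : i = i₀
          · subst hi; rw [hw0, hv0]; linarith
          · rw [hwc i hi, hvc i hi]; ring
        · rw [if_neg hij]
          by_cases hi : i = i₀
          · rw [hvc j (fun h => hij (hi.trans h.symm))]; ring
          · rw [hvc i hi]; ring
  · intro i j hj
    obtain rfl : j = (⟨0, hn⟩ : Fin n).castSucc := Fin.ext hj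
    simp only [R', Fin.snoc_castSucc]
    exact mul_pos (hw i) (hpos _ _ rfl)
  · intro L hL hL0 i j
    rw [mul_diagonal_mul_transpose_apply, hsum]
    have hnn' : ∀ i j, 0 ≤ ∑ k, R i k * L k.castSucc * R j k := by
      intro i j
      have := hnn (fun k => L k.castSucc) (fun a b h => hL (Fin.castSucc_le_castSucc_iff.2 h))
        (fun k => hL0 _) i j
      rwa [mul_diagonal_mul_transpose_apply] at this
    have hd := le_diag_of_le hO (l := fun k => L k.castSucc) (fun k => hL (Fin.le_last _)) i₀
    have hfirst : 0 ≤ w i * w j * ∑ k, R (f i) k * L k.castSucc * R (f j) k :=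
      mul_nonneg (mul_nonneg (hw i).le (hw j).le) (hnn' _ _)
    -- only the two entries pairing the new rows with each other can have `v i * v j < 0`
    have hmixed : 0 ≤ p * q * ∑ k, R i₀ k * L k.castSucc * R i₀ k + -q * p * L (Fin.last n) := by
      have := mul_nonneg (mul_pos hp hq).le (sub_nonneg.2 hd)
      linarith
    have hLn := hL0 (Fin.last n)
    induction i using Fin.lastCases with
    | last =>
      induction j using Fin.lastCases with
      | last => rw [hvl] at *; positivity
      | cast j =>
        by_cases hj : j = i₀
        · subst hj; rw [hwl, hvl, hw0, hv0, hfl, hfc]; linarith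
        · rw [hvc j hj]; linarith
    | cast i =>
      induction j using Fin.lastCases with
      | last =>
        by_cases hi : i = i₀
        · subst hi; rw [hwl, hvl, hw0, hv0, hfl, hfc]; linarith
        · rw [hvc i hi]; linarith
      | cast j =>
        by_cases hi : i = i₀
        · by_cases hj : j = i₀
          · subst hi; subst hj
            have := mul_nonneg (mul_self_nonneg q) hLn
            rw [hv0]; linarith
          · rw [hvc j hj]; linarith
        · rw [hvc i hi]; linarith
  · intro l y
    refine ⟨fun i => (R' * Matrix.diagonal (Fin.snoc (α := fun _ => ℝ) l y) * R'.transpose) i i,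
      fun _ => rfl, fun i hi => ?_, ?_, ?_⟩ <;>
      simp only [mul_diagonal_mul_transpose_apply, hsum, Fin.snoc_castSucc, Fin.snoc_last]
    · rw [hfc, hwc i hi, hvc i hi]; ring
    · rw [hfc, hw0, hv0]; ring
    · rw [hfl, hwl, hvl]

theorem SoulesWith.split {σ A : Multiset ℝ} {c y a b : ℝ} (h : SoulesWith σ (c ::ₘ A))
    (hy : ∀ x ∈ σ, y ≤ x) (ha₀ : 0 ≤ a) (hb₀ : 0 ≤ b) (ha : a < c) (hb : b < c)
    (hab : a + b = c + y) : SoulesWith (y ::ₘ σ) (a ::ₘ b ::ₘ A) := by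
  obtain ⟨n, l, R, hn, hl, rfl, hR, hA, hnn⟩ := h
  obtain ⟨i₀, hi₀⟩ : ∃ i₀, (R * Matrix.diagonal l * R.transpose) i₀ i₀ = c := by
    have : c ∈ c ::ₘ A := Multiset.mem_cons_self c A
    rw [hA] at this
    simpa using this
  have hcy : 0 < c - y := by linarith
  have hyl : ∀ k, y ≤ l k := fun k => hy _ (by simp)
  -- `p` and `q` are the cosine and the sine of the angle by which the row is rotated
  have hp : 0 < (a - y) / (c - y) := div_pos (by linarith) hcy
  have hq : 0 < (b - y) / (c - y) := div_pos (by linarith) hcy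
  have hpp := Real.mul_self_sqrt hp.le
  have hqq := Real.mul_self_sqrt hq.le
  obtain ⟨R', hR', hg⟩ := hR.exists_split hn i₀ (Real.sqrt_pos.2 hp) (Real.sqrt_pos.2 hq) (by
    rw [hpp, hqq, ← add_div, div_eq_one_iff_eq hcy.ne']; linarith)
  obtain ⟨g, hg₀, hg₁, hg₂, hg₃⟩ := hg l y
  rw [hpp, hqq, hi₀] at hg₂
  rw [hpp, hqq, hi₀] at hg₃
  have hga : g i₀.castSucc = a := by
    rw [hg₂]; field_simp
    obtain rfl : b = c + y - a := by linarith
    ring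
  have hgb : g (Fin.last n) = b := by
    rw [hg₃]; field_simp
    obtain rfl : b = c + y - a := by linarith
    ring
  refine ⟨n + 1, Fin.snoc (α := fun _ => ℝ) l y, R', Nat.succ_pos n, antitone_snoc hl hyl, ?_, hR',
    ?_, ?_⟩
  · rw [map_univ_castSucc]
    simp
  · simp only [hg₀]
    rw [map_univ_erase _ i₀, hi₀, Multiset.cons_inj_right] at hA
    rw [map_univ_castSucc, map_univ_erase _ i₀, hga, hgb, Multiset.cons_swap, hA,
      map_erase_congr (g' := fun i => (R * Matrix.diagonal l * R.transpose) i i) hg₁]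
  · intro x hx
    simp only [Multiset.mem_cons] at hx
    rcases hx with rfl | rfl | hx
    exacts [ha₀, hb₀, hnn x (Multiset.mem_cons_of_mem hx)]

theorem soulesWith_singleton {a : ℝ} (ha : 0 ≤ a) : SoulesWith {a} {a} := by
  refine ⟨1, fun _ => a, 1, one_pos, antitone_const, by simp, ⟨one_mem _, ?_, ?_⟩, by simp,
    by simpa using ha⟩
  · intro i j _
    obtain rfl := Subsingleton.elim i j
    simp
  · intro l _ h0 i j
    obtain rfl := Subsingleton.elim i j
    simpa using h0 i

/-- Split off the eigenvalues in decreasing order. A split in which one child equals its parent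
detaches the other child as a list of length one; all other splits extend a Soules matrix. -/
theorem SplitTree.soulesBarWith : ∀ (n : ℕ) {ρ : ℝ} {τ A : Multiset ℝ}, Multiset.card τ = n →
    SplitTree ρ τ A → SoulesBarWith (ρ ::ₘ τ) A := by
  intro n
  induction n with
  | zero =>
    intro ρ τ A hn h
    obtain rfl := Multiset.card_eq_zero.1 hn
    refine ⟨{({ρ}, {ρ})}, ?_, by simp, by simpa using h.leaves_of_eq_zero rfl⟩
    simpa using soulesWith_singleton h.root_nonneg
  | succ n ih =>
    intro ρ τ A hn h
    have hτ : τ ≠ 0 := by rintro rfl; simp at hn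
    obtain ⟨y, hy, hmin⟩ : ∃ y ∈ τ, ∀ x ∈ τ, y ≤ x := Multiset.exists_min_image id hτ
    have hyρ := h.le_root y hy
    obtain ⟨τ', A', c, a, b, rfl, rfl, h', ha, hb, hac, hbc, e⟩ :=
      SplitTree.exists_bottom_of_min _ rfl h y hy hmin
    obtain ⟨s, hs, hs₁, hs₂⟩ := ih (by simpa using hn) h'
    have detach : ∀ {y}, 0 ≤ y →
        SoulesBarWith (ρ ::ₘ y ::ₘ τ') (c ::ₘ y ::ₘ A') := by
      intro y hy
      refine ⟨({y}, {y}) ::ₘ s, ?_, ?_, ?_⟩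
      · intro q hq
        rcases Multiset.mem_cons.1 hq with rfl | hq
        exacts [soulesWith_singleton hy, hs q hq]
      · rw [Multiset.map_cons, Multiset.sum_cons, ← hs₁, Multiset.cons_swap]; rfl
      · rw [Multiset.map_cons, Multiset.sum_cons, ← hs₂, Multiset.cons_swap]; rfl
    rcases hac.eq_or_lt with rfl | hac
    · obtain rfl : b = y := by linarith
      exact detach hb
    rcases hbc.eq_or_lt with rfl | hbc
    · obtain rfl : a = y := by linarith
      rw [Multiset.cons_swap a b]
      exact detach ha
    have hc : c ∈ (s.map Prod.snd).sum := hs₂ ▸ Multiset.mem_cons_self c A'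
    rw [← Multiset.join, ← Multiset.bind, Multiset.mem_bind] at hc
    obtain ⟨⟨σ, B'⟩, hq, hcB⟩ := hc
    obtain ⟨s', rfl⟩ := Multiset.exists_cons_of_mem hq
    obtain ⟨B, rfl⟩ := Multiset.exists_cons_of_mem hcB
    have hσ := hs _ hq
    rw [Multiset.map_cons, Multiset.sum_cons] at hs₁ hs₂
    refine ⟨(y ::ₘ σ, a ::ₘ b ::ₘ B) ::ₘ s', ?_, ?_, ?_⟩
    · intro q hq
      rcases Multiset.mem_cons.1 hq with rfl | hq
      · refine hσ.split (fun x hx => ?_) ha hb hac hbc e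
        have : x ∈ ρ ::ₘ τ' := hs₁ ▸ Multiset.mem_add.2 (.inl hx)
        rcases Multiset.mem_cons.1 this with rfl | hx
        exacts [hyρ, hmin x (Multiset.mem_cons_of_mem hx)]
      · exact hs q (Multiset.mem_cons_of_mem hq)
    · rw [Multiset.map_cons, Multiset.sum_cons, Multiset.cons_swap, hs₁, Multiset.cons_add]
    · rw [Multiset.map_cons, Multiset.sum_cons, Multiset.cons_add, Multiset.cons_add,
        Multiset.cons_inj_right, Multiset.cons_inj_right]
      simpa using hs₂

/-- The last column of a Soules matrix has exactly one negative and one positive entry: it is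
orthogonal to the positive first column, and any two of its entries have product `≤ 0`, because the
remaining columns contribute a nonnegative amount to the off-diagonal entries of `R Rᵀ = 1`. -/
theorem IsSoulesMatrix.exists_last_column {n : ℕ} {R : Matrix (Fin (n + 2)) (Fin (n + 2)) ℝ}
    (hR : IsSoulesMatrix R) : ∃ i₁ i₂ : Fin (n + 2), R i₁ (Fin.last _) < 0 ∧
      0 < R i₂ (Fin.last _) ∧ ∀ i, i ≠ i₁ → i ≠ i₂ → R i (Fin.last _) = 0 := by
  obtain ⟨hO, hpos, hnn⟩ := hR
  have hrow := mem_orthogonalGroup_iff_rows.1 hO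
  have hcol := mem_orthogonalGroup_iff_columns.1 hO
  have h1 : ∑ i, R i (Fin.last _) * R i (Fin.last _) = 1 := by
    rw [hcol, if_pos rfl]
  have h0 : ∑ i, R i 0 * R i (Fin.last _) = 0 := by
    rw [hcol, if_neg (Fin.last_pos).ne]
  have hu : ∀ i, 0 < R i 0 := fun i => hpos i 0 rfl
  have hoff : ∀ i j, i ≠ j → R i (Fin.last _) * R j (Fin.last _) ≤ 0 := by
    intro i j hij
    have h2 := hnn (Fin.snoc (α := fun _ => ℝ) (fun _ => 1) 0)
      (antitone_snoc antitone_const fun _ => zero_le_one) (fun k => by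
        induction k using Fin.lastCases <;> simp) i j
    have h3 := hrow i j
    rw [if_neg hij, Fin.sum_univ_castSucc] at h3
    rw [mul_diagonal_mul_transpose_apply, Fin.sum_univ_castSucc] at h2
    simp only [Fin.snoc_castSucc, Fin.snoc_last, mul_one, mul_zero, zero_mul, add_zero] at h2
    linarith
  have hzero : (∀ i, R i 0 * R i (Fin.last _) = 0) → False := by
    intro h
    have : ∀ i, R i (Fin.last _) = 0 := fun i => (mul_eq_zero.1 (h i)).resolve_left (hu i).ne'
    simp [this] at h1
  have hneg : ∃ i₁, R i₁ (Fin.last _) < 0 := by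
    by_contra! h
    refine hzero fun i => ?_
    exact (Finset.sum_eq_zero_iff_of_nonneg fun i _ => mul_nonneg (hu i).le (h i)).1 h0 i
      (mem_univ i)
  have hpos' : ∃ i₂, 0 < R i₂ (Fin.last _) := by
    by_contra! h
    refine hzero fun i => ?_
    exact (Finset.sum_eq_zero_iff_of_nonpos fun i _ =>
      mul_nonpos_of_nonneg_of_nonpos (hu i).le (h i)).1 h0 i (mem_univ i)
  obtain ⟨i₁, h₁⟩ := hneg
  obtain ⟨i₂, h₂⟩ := hpos'
  refine ⟨i₁, i₂, h₁, h₂, fun i hi₁ hi₂ => le_antisymm ?_ ?_⟩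
  · by_contra! h
    exact absurd (hoff i i₂ hi₂) (mul_pos h h₂).not_ge
  · by_contra! h
    exact absurd (hoff i i₁ hi₁) (mul_pos_of_neg_of_neg h h₁).not_ge

/-- Deleting the last column of a Soules matrix and merging the two rows that meet its support gives
a Soules matrix of size one smaller, in which the two corresponding diagonal entries `a`, `b` are
replaced by a single entry `d` with `d + l (last) = a + b` and `a, b ≤ d`. -/
theorem IsSoulesMatrix.exists_merge {n : ℕ} {R : Matrix (Fin (n + 2)) (Fin (n + 2)) ℝ}
    (hR : IsSoulesMatrix R) {l : Fin (n + 2) → ℝ} (hl : Antitone l) :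
    ∃ R₁ : Matrix (Fin (n + 1)) (Fin (n + 1)) ℝ, IsSoulesMatrix R₁ ∧
      ∃ (d a b : ℝ) (A : Multiset ℝ),
      univ.val.map (fun i => (R * Matrix.diagonal l * R.transpose) i i) = a ::ₘ b ::ₘ A ∧
      univ.val.map (fun i =>
        (R₁ * Matrix.diagonal (fun k : Fin (n + 1) => l k.castSucc) * R₁.transpose) i i) =
        d ::ₘ A ∧
      a ≤ d ∧ b ≤ d ∧ a + b = d + l (Fin.last _) := by
  obtain ⟨i₁, i₂, h₁, h₂, hz⟩ := hR.exists_last_column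
  obtain ⟨hO, hpos, hnn⟩ := hR
  have hrow := mem_orthogonalGroup_iff_rows.1 hO
  have hcol := mem_orthogonalGroup_iff_columns.1 hO
  have hne : i₁ ≠ i₂ := by rintro rfl; linarith
  have hnorm : R i₁ (Fin.last _) * R i₁ (Fin.last _) +
      R i₂ (Fin.last _) * R i₂ (Fin.last _) = 1 := by
    rw [← Fintype.sum_eq_add i₁ i₂ hne
      (f := fun i => R i (Fin.last _) * R i (Fin.last _)), hcol, if_pos rfl]
    rintro i ⟨hi₁, hi₂⟩
    simp [hz i hi₁ hi₂]
  have horth : ∀ j : Fin (n + 1), R i₁ j.castSucc * R i₁ (Fin.last _) +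
      R i₂ j.castSucc * R i₂ (Fin.last _) = 0 := by
    intro j
    rw [← Fintype.sum_eq_add i₁ i₂ hne
      (f := fun i => R i j.castSucc * R i (Fin.last _)), hcol, if_neg (Fin.castSucc_lt_last _).ne]
    rintro i ⟨hi₁, hi₂⟩
    simp [hz i hi₁ hi₂]
  set s := R i₁ (Fin.last _) with hs
  set c := R i₂ (Fin.last _) with hc
  obtain ⟨k₁, hk₁⟩ := Fin.exists_succAbove_eq hne
  have hk : ∀ k, k ≠ k₁ → i₂.succAbove k ≠ i₁ := fun k hk h =>
    hk (Fin.succAbove_right_injective (h.trans hk₁.symm))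
  have hzk : ∀ k, k ≠ k₁ → R (i₂.succAbove k) (Fin.last _) = 0 := fun k hk' =>
    hz _ (hk k hk') (Fin.succAbove_ne i₂ k)
  let w : Fin (n + 1) → ℝ := fun k => if k = k₁ then c else 1
  have hw : ∀ k, 0 < w k := fun k => by
    simp only [w]; split_ifs
    exacts [h₂, one_pos]
  have hwk₁ : w k₁ = c := if_pos rfl
  have hwk : ∀ k, k ≠ k₁ → w k = 1 := fun k hk => if_neg hk
  let R₁ : Matrix (Fin (n + 1)) (Fin (n + 1)) ℝ :=
    fun k j => R (i₂.succAbove k) j.castSucc / w k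
  have hsum : ∀ (L : Fin (n + 1) → ℝ) (k k' : Fin (n + 1)), ∑ j, R₁ k j * L j * R₁ k' j =
      (∑ j : Fin (n + 1), R (i₂.succAbove k) j.castSucc * L j * R (i₂.succAbove k') j.castSucc) /
        (w k * w k') := by
    intro L k k'
    rw [Finset.sum_div]
    refine Finset.sum_congr rfl fun j _ => ?_
    have := (hw k).ne'
    have := (hw k').ne'
    simp only [R₁]
    field_simp
  have hO₁ : R₁ ∈ Matrix.orthogonalGroup (Fin (n + 1)) ℝ := by
    rw [mem_orthogonalGroup_iff_rows]
    intro k k'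
    have h3 := hsum (fun _ => 1) k k'
    have h4 := hrow (i₂.succAbove k) (i₂.succAbove k')
    rw [Fin.sum_univ_castSucc] at h4
    simp only [mul_one] at h3
    rw [h3, div_eq_iff (mul_pos (hw k) (hw k')).ne', eq_sub_of_add_eq h4]
    simp only [Fin.succAbove_right_inj]
    by_cases hkk : k = k'
    · subst hkk
      by_cases hk1 : k = k₁
      · subst hk1
        simp only [if_true, hk₁, hwk₁, ← hs]
        linarith
      · simp [hzk k hk1, hwk k hk1]
    · rw [if_neg hkk]
      by_cases hk1 : k = k₁
      · rw [hzk k' (fun h => hkk (hk1.trans h.symm))]; ring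
      · rw [hzk k hk1]; ring
  refine ⟨R₁, ⟨hO₁, ?_, ?_⟩, ?_⟩
  · intro k j hj
    exact div_pos (hpos _ _ hj) (hw k)
  · intro L hL hL0 k k'
    rw [mul_diagonal_mul_transpose_apply, hsum]
    refine div_nonneg ?_ (mul_pos (hw k) (hw k')).le
    have h2 := hnn (Fin.snoc (α := fun _ => ℝ) L 0) (antitone_snoc hL hL0) (fun k => by
      induction k using Fin.lastCases with
      | last => simp
      | cast k => simpa using hL0 k) (i₂.succAbove k) (i₂.succAbove k')
    rw [mul_diagonal_mul_transpose_apply, Fin.sum_univ_castSucc] at h2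
    simpa using h2
  · set S := ∑ j : Fin (n + 1), R i₁ j.castSucc * l j.castSucc * R i₁ j.castSucc with hS
    have hS₂ : ∑ j : Fin (n + 1), R i₂ j.castSucc * l j.castSucc * R i₂ j.castSucc =
        s * s / (c * c) * S := by
      rw [hS, Finset.mul_sum]
      refine Finset.sum_congr rfl fun j _ => ?_
      have : R i₂ j.castSucc = -(R i₁ j.castSucc * s) / c := by
        rw [eq_div_iff h₂.ne']; linarith [horth j]
      rw [this]
      field_simp
    have hd : S / (c * c) = ∑ j, R₁ k₁ j * l j.castSucc * R₁ k₁ j := by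
      rw [hsum, hk₁, hwk₁]
    have hyd : l (Fin.last _) ≤ S / (c * c) :=
      hd ▸ le_diag_of_le hO₁ (l := fun k => l k.castSucc) (fun k => hl (Fin.le_last _)) k₁
    have hSc : S = c * c * (S / (c * c)) := by field_simp
    have hSs : s * s / (c * c) * S = s * s * (S / (c * c)) := by ring
    have hcc : ∀ x, c * c * x = x - s * s * x := fun x => by
      rw [eq_sub_of_add_eq' hnorm]; ring
    generalize S / (c * c) = d at hd hyd hSc hSs
    refine ⟨d, S + s * s * l (Fin.last _), s * s / (c * c) * S + c * c * l (Fin.last _),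
      (univ.erase k₁).val.map fun k => (R * Matrix.diagonal l * R.transpose)
        (i₂.succAbove k) (i₂.succAbove k), ?_, ?_, ?_, ?_, ?_⟩
    · rw [map_univ_succAbove _ i₂, map_univ_erase _ k₁, Multiset.cons_swap]
      congr 1
      · simp only [hk₁, mul_diagonal_mul_transpose_apply]
        rw [Fin.sum_univ_castSucc (n := n + 1)]
        rw [← hS, ← hs]; ring
      · congr 1
        simp only [mul_diagonal_mul_transpose_apply]
        rw [Fin.sum_univ_castSucc (n := n + 1)]
        rw [hS₂, ← hc]; ring
    · rw [map_univ_erase _ k₁]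
      congr 1
      · rw [mul_diagonal_mul_transpose_apply, hd]
      · refine map_erase_congr fun k hk => ?_
        simp only [mul_diagonal_mul_transpose_apply]
        rw [hsum, hwk k hk, Fin.sum_univ_castSucc (n := n + 1), hzk k hk]
        ring
    · linarith [mul_nonneg (mul_self_nonneg s) (sub_nonneg.2 hyd), hcc d]
    · linarith [mul_nonneg (mul_self_nonneg c) (sub_nonneg.2 hyd), hcc d]
    · linarith [hcc d, hcc (l (Fin.last _))]

theorem IsSoulesMatrix.splitTree : ∀ (n : ℕ) (l : Fin (n + 1) → ℝ)
    (R : Matrix (Fin (n + 1)) (Fin (n + 1)) ℝ), Antitone l → IsSoulesMatrix R →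
    (∀ x ∈ univ.val.map fun i => (R * Matrix.diagonal l * R.transpose) i i, 0 ≤ x) →
    SplitTree (l 0) (univ.val.map fun k : Fin n => l k.succ)
      (univ.val.map fun i => (R * Matrix.diagonal l * R.transpose) i i) := by
  intro n
  induction n with
  | zero =>
    intro l R hl hR hnn
    have h1 := mem_orthogonalGroup_iff_rows.1 hR.1 0 0
    have h2 : (R * Matrix.diagonal l * R.transpose) 0 0 = l 0 := by
      rw [mul_diagonal_mul_transpose_apply]
      simp only [Fin.sum_univ_succ, Finset.univ_eq_empty, Finset.sum_empty, add_zero,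
        if_true] at h1 ⊢
      rw [mul_right_comm, h1, one_mul]
    have h3 : 0 ≤ l 0 := by rw [← h2]; exact hnn _ (by simp)
    simpa [h2] using SplitTree.leaf (l 0) h3
  | succ n ih =>
    intro l R hl hR hnn
    obtain ⟨R₁, hR₁, d, a, b, A, e, e₁, had, hbd, hs⟩ := IsSoulesMatrix.exists_merge hR hl
    rw [e] at hnn ⊢
    have ha := hnn a (by simp)
    have hb := hnn b (by simp)
    have := ih (fun k => l k.castSucc) R₁
      (fun i j h => hl (Fin.castSucc_le_castSucc_iff.2 h)) hR₁ (by
      rw [e₁]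
      intro x hx
      rcases Multiset.mem_cons.1 hx with rfl | hx
      · exact ha.trans had
      · exact hnn x (by simp [hx]))
    have h' := SplitTree.node' had hbd hs (.leaf a ha) (.leaf b hb)
    have h'' := this.graft h' A e₁
    rw [map_univ_castSucc]
    convert h'' using 1
    · rw [Fin.castSucc_zero]
    · simp only [Fin.succ_last, Fin.succ_castSucc, add_zero, Multiset.add_cons]
    · rw [add_comm A, add_assoc]
      simp only [Multiset.singleton_add]

end Soules

theorem SoulesWith.exists_splitTree {σ A : Multiset ℝ} (h : SoulesWith σ A) :
    ∃ ρ τ, σ = ρ ::ₘ τ ∧ SplitTree ρ τ A := by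
  obtain ⟨n, l, R, hn, hl, rfl, hR, rfl, hnn⟩ := h
  obtain ⟨n, rfl⟩ := Nat.exists_eq_succ_of_ne_zero hn.ne'
  refine ⟨l 0, _, ?_, IsSoulesMatrix.splitTree n l R hl hR hnn⟩
  rw [map_univ_succAbove l 0]
  simp

theorem soulesBarWith_cons_iff {ρ : ℝ} {τ A : Multiset ℝ} (hρ : ∀ x ∈ τ, x ≤ ρ) :
    SoulesBarWith (ρ ::ₘ τ) A ↔ SplitTree ρ τ A := by
  refine ⟨?_, SplitTree.soulesBarWith _ rfl⟩
  have key : ∀ s : Multiset (Multiset ℝ × Multiset ℝ), (∀ q ∈ s, SoulesWith q.1 q.2) →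
      s ≠ 0 → ∃ ρ τ, (s.map Prod.fst).sum = ρ ::ₘ τ ∧ SplitTree ρ τ (s.map Prod.snd).sum := by
    intro s
    induction s using Multiset.induction with
    | empty => simp
    | cons q s ih =>
      intro hs _
      obtain ⟨ρ₁, τ₁, e₁, h₁⟩ := (hs q (Multiset.mem_cons_self _ _)).exists_splitTree
      rcases eq_or_ne s 0 with rfl | h0
      · exact ⟨ρ₁, τ₁, by simpa using e₁, by simpa using h₁⟩
      obtain ⟨ρ₂, τ₂, e₂, h₂⟩ := ih (fun q hq => hs q (Multiset.mem_cons_of_mem hq)) h0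
      simp only [Multiset.map_cons, Multiset.sum_cons, e₁, e₂]
      rcases le_total ρ₂ ρ₁ with hle | hle
      · exact ⟨ρ₁, ρ₂ ::ₘ (τ₁ + τ₂), by simp [Multiset.cons_swap], h₁.join h₂ hle⟩
      · refine ⟨ρ₂, ρ₁ ::ₘ (τ₂ + τ₁), ?_, ?_⟩
        · rw [add_comm]; simp [Multiset.cons_swap]
        · rw [add_comm q.2]; exact h₂.join h₁ hle
  rintro ⟨s, hs, e₁, rfl⟩
  obtain ⟨ρ', τ', e', h'⟩ := key s hs (by rintro rfl; simp at e₁)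
  obtain ⟨rfl, rfl⟩ := eq_of_cons_eq_cons_of_max (e₁.trans e') hρ h'.le_root
  exact h'

/-! ### The first Soto criterion -/

theorem entry_cons_one {ρ : ℝ} {τ : Multiset ℝ} (hρ : ∀ x ∈ τ, x ≤ ρ) :
    entry (ρ ::ₘ τ) 1 = ρ := by
  rw [entry, Multiset.sort_cons ρ τ (· ≥ ·) hρ]
  rfl

theorem entry_cons_of_two_le {ρ : ℝ} {τ : Multiset ℝ} (hρ : ∀ x ∈ τ, x ≤ ρ) {i : ℕ} (hi : 2 ≤ i) :
    entry (ρ ::ₘ τ) i = entry τ (i - 1) := by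
  obtain ⟨k, rfl⟩ := Nat.exists_eq_add_of_le' hi
  rw [entry, Multiset.sort_cons ρ τ (· ≥ ·) hρ]
  rfl

theorem entry_le_entry {σ : Multiset ℝ} {i j : ℕ} (hi : 1 ≤ i) (hij : i ≤ j)
    (hj : j ≤ Multiset.card σ) : entry σ j ≤ entry σ i := by
  rcases hij.eq_or_lt with rfl | hij
  · exact le_rfl
  have hlen : (σ.sort (· ≥ ·)).length = Multiset.card σ := Multiset.length_sort (r := (· ≥ ·))
  have h := List.pairwise_iff_getElem.1 (Multiset.pairwise_sort σ (· ≥ ·)) (i - 1) (j - 1)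
    (by omega) (by omega) (by omega)
  rw [entry, entry, List.getD_eq_getElem _ _ (by omega), List.getD_eq_getElem _ _ (by omega)]
  exact h

theorem sum_range_getD (L : List ℝ) :
    ∑ i ∈ Finset.range L.length, ({L.getD i 0} : Multiset ℝ) = (L : Multiset ℝ) := by
  induction L with
  | nil => rfl
  | cons x L ih =>
    rw [List.length_cons, Finset.sum_range_succ']
    simp only [List.getD_cons_succ, List.getD_cons_zero, ih]
    rw [add_comm, Multiset.singleton_add, Multiset.cons_coe]

theorem sum_entry (σ : Multiset ℝ) :
    ∑ i ∈ Finset.Icc 1 (Multiset.card σ), ({entry σ i} : Multiset ℝ) = σ := by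
  have h := sum_range_getD (σ.sort (· ≥ ·))
  rw [Multiset.sort_eq, Multiset.length_sort] at h
  conv_rhs => rw [← h]
  refine Finset.sum_nbij' (fun i => i - 1) (fun i => i + 1) ?_ ?_ ?_ ?_ ?_ <;>
    simp only [Finset.mem_Icc, Finset.mem_range] <;> intro i hi
  · omega
  · omega
  · omega
  · omega
  · rfl

/-- Summation over `1, …, n` with `i` paired with `n + 1 - i`. -/
theorem sum_Icc_eq_sum_pairs {M : Type*} [AddCommMonoid M] (g : ℕ → M) {n : ℕ} (hn : 2 ≤ n) :
    ∑ i ∈ Finset.Icc 1 n, g i = g 1 + (g n + ∑ i ∈ Finset.Icc 2 ((n + 1) / 2),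
      if 2 * i = n + 1 then g i else g i + g (n + 1 - i)) := by
  have h₁ : Finset.Icc 1 n = Finset.Icc 1 ((n + 1) / 2) ∪ Finset.Icc ((n + 1) / 2 + 1) n := by
    ext i; simp only [Finset.mem_union, Finset.mem_Icc]; omega
  have h₂ : Disjoint (Finset.Icc 1 ((n + 1) / 2)) (Finset.Icc ((n + 1) / 2 + 1) n) := by
    rw [Finset.disjoint_left]
    intro i; simp only [Finset.mem_Icc]; omega
  have h₃ : ∑ i ∈ Finset.Icc ((n + 1) / 2 + 1) n, g i =
      ∑ i ∈ (Finset.Icc 1 ((n + 1) / 2)).filter (fun i => ¬ 2 * i = n + 1), g (n + 1 - i) := by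
    refine Finset.sum_nbij' (fun i => n + 1 - i) (fun i => n + 1 - i) ?_ ?_ ?_ ?_ ?_ <;>
      simp only [Finset.mem_Icc, Finset.mem_filter] <;> intro i hi
    · omega
    · omega
    · omega
    · omega
    · congr 1; omega
  have h₄ : Finset.Icc 1 ((n + 1) / 2) = insert 1 (Finset.Icc 2 ((n + 1) / 2)) := by
    ext i; simp only [Finset.mem_insert, Finset.mem_Icc]; omega
  rw [h₁, Finset.sum_union h₂, h₃, Finset.sum_filter, ← Finset.sum_add_distrib, h₄,
    Finset.sum_insert (by simp), if_pos (by omega), Nat.add_sub_cancel, add_assoc]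
  congr 2
  refine Finset.sum_congr rfl fun i _ => ?_
  split_ifs <;> simp_all

/-- The entries that contribute to `sotoT σ i`. -/
noncomputable def sotoPair (σ : Multiset ℝ) (i : ℕ) : Multiset ℝ :=
  if 2 * i = Multiset.card σ + 1 then {entry σ i}
  else {entry σ i} + {entry σ (Multiset.card σ + 1 - i)}

theorem eq_entry_add_sum_sotoPair {ρ : ℝ} {τ : Multiset ℝ} (hρ : ∀ x ∈ τ, x ≤ ρ)
    (hτ : τ ≠ 0) :
    τ = {entry (ρ ::ₘ τ) (Multiset.card (ρ ::ₘ τ))} +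
      ∑ i ∈ Finset.Icc 2 ((Multiset.card (ρ ::ₘ τ) + 1) / 2), sotoPair (ρ ::ₘ τ) i := by
  have hcard := Multiset.card_pos.2 hτ
  have h := sum_Icc_eq_sum_pairs (fun i => ({entry (ρ ::ₘ τ) i} : Multiset ℝ))
    (n := Multiset.card (ρ ::ₘ τ)) (by rw [Multiset.card_cons]; omega)
  rw [sum_entry, entry_cons_one hρ, Multiset.singleton_add, Multiset.cons_inj_right] at h
  exact h

theorem sotoOne_iff {σ : Multiset ℝ} : SotoOne σ ↔
    - entry σ (Multiset.card σ)
      - ∑ i ∈ Finset.Icc 2 ((Multiset.card σ + 1) / 2), min (sotoT σ i) 0 ≤ entry σ 1 := by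
  rw [SotoOne, ge_iff_le, Finset.sum_filter]
  have : ∀ x : ℝ, (if x < 0 then x else 0) = min x 0 := fun x => by
    split_ifs with h
    exacts [(min_eq_left h.le).symm, (min_eq_right (not_lt.1 h)).symm]
  simp only [← this]

theorem sotoOne_singleton_iff {ρ : ℝ} : SotoOne {ρ} ↔ 0 ≤ ρ := by
  have h1 : entry {ρ} 1 = ρ := entry_cons_one (τ := 0) (by simp)
  rw [sotoOne_iff, Multiset.card_singleton, h1]
  simp only [Nat.reduceAdd, Nat.reduceDiv]
  rw [Finset.Icc_eq_empty (by norm_num), Finset.sum_empty]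
  constructor <;> intro h <;> linarith

namespace Feasible

variable {ρ p q : ℝ} {τ : Multiset ℝ}

theorem singleton (h₁ : q ≤ ρ) (h₂ : -q ≤ ρ) : Feasible ρ {q} := by
  have h := node (ρ := ρ) (a := ρ + min q 0) (b := max q 0) (y := q) (τ₁ := 0) (τ₂ := 0)
    (by linarith [min_le_right q 0]) (max_le h₁ (by linarith))
    (by linarith [min_add_max q 0])
    (leaf (by rcases min_choice q 0 with h | h <;> rw [h] <;> linarith))
    (leaf (le_max_right _ _))
  simpa using h

/-- Joining the feasible list `(p; τ')` does not raise the root when `p ≤ ρ`. -/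
theorem union {τ' : Multiset ℝ} (h : Feasible ρ τ) (h' : Feasible p τ') (hp : p ≤ ρ) :
    Feasible ρ (τ + (p ::ₘ τ')) := by
  rw [Multiset.add_cons]
  exact node le_rfl hp rfl h h'

/-- A list `(p; τ')` which becomes feasible when its first entry is raised by `ε` can be joined at
the cost of raising the root by `ε`. -/
theorem compensate {τ' : Multiset ℝ} {ε : ℝ} (hε : 0 ≤ ε) (h : Feasible ρ τ)
    (h' : Feasible (p + ε) τ') (hp : p ≤ ρ) : Feasible (ρ + ε) (τ + (p ::ₘ τ')) := by
  rw [Multiset.add_cons]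
  exact node (by linarith) (by linarith) (by ring) h h'

/-- Joining entries `i` and `n + 1 - i` with `sotoT σ i < 0` costs `-sotoT σ i`. The root dominates
entry `i` because it dominates the negative of the last entry. -/
theorem add_sotoPair_of_neg {σ : Multiset ℝ} {i : ℕ} (hi : 2 ≤ i)
    (hi' : i ≤ (Multiset.card σ + 1) / 2) (hT : sotoT σ i < 0) (h : Feasible ρ τ)
    (hρ : -entry σ (Multiset.card σ) ≤ ρ) : Feasible (ρ - sotoT σ i) (τ + sotoPair σ i) := by
  rw [sub_eq_add_neg]
  unfold sotoT sotoPair at *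
  split_ifs at * with hc
  · have h0 : entry σ i < 0 := by
      rcases min_lt_iff.1 hT with h | h
      exacts [h, absurd h (lt_irrefl _)]
    rw [min_eq_left h0.le]
    exact h.compensate (by linarith) (leaf (by linarith)) (h0.le.trans h.nonneg)
  · have h1 : entry σ (Multiset.card σ + 1 - i) ≤ entry σ i :=
      entry_le_entry (by omega) (by omega) (by omega)
    have h2 : entry σ (Multiset.card σ) ≤ entry σ (Multiset.card σ + 1 - i) :=
      entry_le_entry (by omega) (by omega) le_rfl
    exact h.compensate (by linarith) (singleton (by linarith) (by linarith)) (by linarith)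

theorem add_sotoPair_of_nonneg {σ : Multiset ℝ} {i : ℕ} (hi : 2 ≤ i)
    (hi' : i ≤ (Multiset.card σ + 1) / 2) (hT : 0 ≤ sotoT σ i) (h : Feasible ρ τ)
    (hρ : entry σ 1 ≤ ρ) : Feasible ρ (τ + sotoPair σ i) := by
  have h1 : entry σ i ≤ entry σ 1 := entry_le_entry le_rfl (by omega) (by omega)
  unfold sotoT sotoPair at *
  split_ifs at * with hc
  · exact h.union (leaf (hT.trans (min_le_left _ _))) (h1.trans hρ)
  · have h1 : entry σ (Multiset.card σ + 1 - i) ≤ entry σ i :=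
      entry_le_entry (by omega) (by omega) (by omega)
    exact h.union (singleton h1 (by linarith)) (by linarith)

end Feasible

/-- The pairs with `T < 0` are joined first, starting from the pair of the last entry and a root
just large enough; the remaining pairs cost nothing. -/
theorem SotoOne.feasible {ρ : ℝ} {τ : Multiset ℝ} (hρ : ∀ x ∈ τ, x ≤ ρ)
    (h : SotoOne (ρ ::ₘ τ)) : Feasible ρ τ := by
  rcases eq_or_ne τ 0 with rfl | hτ
  · exact .leaf (sotoOne_singleton_iff.1 h)
  rw [sotoOne_iff, entry_cons_one hρ] at h
  have e := eq_entry_add_sum_sotoPair hρ hτ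
  have e1 := entry_cons_one hρ
  have hcard : 1 ≤ Multiset.card (ρ ::ₘ τ) := by simp
  generalize ρ ::ₘ τ = σ at h e e1 hcard
  set J := Finset.Icc 2 ((Multiset.card σ + 1) / 2) with hJ
  set q := entry σ (Multiset.card σ)
  have hqρ : q ≤ ρ := e1 ▸ entry_le_entry le_rfl hcard le_rfl
  have hsum : ∑ i ∈ J.filter (fun i => sotoT σ i < 0), sotoT σ i = ∑ i ∈ J, min (sotoT σ i) 0 := by
    rw [Finset.sum_filter]
    refine Finset.sum_congr rfl fun i _ => ?_
    split_ifs with h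
    exacts [(min_eq_left h.le).symm, (min_eq_right (not_lt.1 h)).symm]
  set r := ρ + ∑ i ∈ J, min (sotoT σ i) 0 with hr
  have hqr : -q ≤ r := by linarith
  have hqr' : q ≤ r := by
    rcases lt_or_ge q 0 with hq | hq
    · linarith
    · have : ∑ i ∈ J, min (sotoT σ i) 0 = 0 := by
        refine Finset.sum_eq_zero fun i hi => min_eq_right ?_
        rw [hJ, Finset.mem_Icc] at hi
        have hq₁ : 0 ≤ entry σ i := hq.trans (entry_le_entry (by omega) (by omega) le_rfl)
        have hq₂ : 0 ≤ entry σ (Multiset.card σ + 1 - i) :=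
          hq.trans (entry_le_entry (by omega) (by omega) le_rfl)
        unfold sotoT
        split_ifs
        exacts [le_min hq₁ le_rfl, add_nonneg hq₁ hq₂]
      rw [hr, this, add_zero]
      exact hqρ
  have key₁ : ∀ I ⊆ J.filter (fun i => sotoT σ i < 0),
      Feasible (r - ∑ i ∈ I, sotoT σ i) ({q} + ∑ i ∈ I, sotoPair σ i) := by
    intro I
    induction I using Finset.induction_on with
    | empty =>
      intro _
      simpa using Feasible.singleton hqr' hqr
    | insert i I hi ih =>
      intro hI
      have hiJ := Finset.mem_filter.1 (hI (Finset.mem_insert_self i I))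
      have hI' := (Finset.subset_insert i I).trans hI
      have hi' := Finset.mem_Icc.1 hiJ.1
      have hneg : ∑ i ∈ I, sotoT σ i ≤ 0 :=
        Finset.sum_nonpos fun j hj => (Finset.mem_filter.1 (hI' hj)).2.le
      have := (ih hI').add_sotoPair_of_neg hi'.1 hi'.2 hiJ.2 (by linarith)
      rw [Finset.sum_insert hi, Finset.sum_insert hi]
      convert this using 1
      · ring
      · abel
  have key₂ : ∀ I ⊆ J.filter (fun i => ¬ sotoT σ i < 0), Feasible ρ
      ({q} + ∑ i ∈ J.filter (fun i => sotoT σ i < 0), sotoPair σ i + ∑ i ∈ I, sotoPair σ i) := by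
    intro I
    induction I using Finset.induction_on with
    | empty =>
      intro _
      have := key₁ _ subset_rfl
      rw [hsum, hr, add_sub_cancel_right] at this
      simpa using this
    | insert i I hi ih =>
      intro hI
      have hiJ := Finset.mem_filter.1 (hI (Finset.mem_insert_self i I))
      have hi' := Finset.mem_Icc.1 hiJ.1
      have := (ih ((Finset.subset_insert i I).trans hI)).add_sotoPair_of_nonneg hi'.1 hi'.2
        (not_lt.1 hiJ.2) e1.le
      rw [Finset.sum_insert hi]
      convert this using 1
      abel
  have := key₂ _ subset_rfl
  rwa [add_assoc, Finset.sum_filter_add_sum_filter_not, ← e] at this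

/-- If all entries but the first are negative, the first Soto criterion says that the sum of the
entries is nonnegative. -/
theorem Feasible.sotoOne_of_neg {ρ : ℝ} {τ : Multiset ℝ} (h : Feasible ρ τ)
    (hneg : ∀ x ∈ τ, x < 0) : SotoOne (ρ ::ₘ τ) := by
  rcases eq_or_ne τ 0 with rfl | hτ
  · exact sotoOne_singleton_iff.2 h.nonneg
  have e := eq_entry_add_sum_sotoPair h.le_root hτ
  have htrace : 0 ≤ ρ + τ.sum := by
    obtain ⟨A, hA⟩ := h
    rw [hA.sum_eq]
    exact Multiset.sum_nonneg hA.leaves_nonneg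
  rw [sotoOne_iff, entry_cons_one h.le_root]
  generalize ρ ::ₘ τ = σ at e
  set J := Finset.Icc 2 ((Multiset.card σ + 1) / 2)
  have hmem : ∀ i ∈ J, ∀ x ∈ sotoPair σ i, x < 0 := by
    intro i hi x hx
    refine hneg x ?_
    rw [e]
    exact Multiset.mem_add.2 (.inr (Multiset.mem_sum.2 ⟨i, hi, hx⟩))
  have hT : ∀ i ∈ J, min (sotoT σ i) 0 = (sotoPair σ i).sum := by
    intro i hi
    have h' := hmem i hi
    unfold sotoPair sotoT at *
    split_ifs at * with hc
    · have := h' _ (Multiset.mem_singleton_self _)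
      simp [this.le]
    · have h₁ := h' (entry σ i) (by simp)
      have h₂ := h' (entry σ (Multiset.card σ + 1 - i)) (by simp)
      rw [min_eq_left (by linarith)]
      simp
  have hsum : τ.sum = entry σ (Multiset.card σ) + ∑ i ∈ J, (sotoPair σ i).sum := by
    have := congrArg Multiset.sumAddMonoidHom e
    rw [map_add, map_sum] at this
    simpa using this
  rw [Finset.sum_congr rfl hT]
  linarith

theorem exists_sotoOne {ρ : ℝ} {τ : Multiset ℝ} (h0 : 0 ≤ ρ) (hρ : ∀ x ∈ τ, x ≤ ρ) :
    ∃ ε, 0 ≤ ε ∧ SotoOne ((ρ + ε) ::ₘ τ) := by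
  rcases eq_or_ne τ 0 with rfl | hτ
  · exact ⟨0, le_rfl, sotoOne_singleton_iff.2 (by linarith)⟩
  have hcard := Multiset.card_pos.2 hτ
  set B : ℝ := - entry (ρ ::ₘ τ) (Multiset.card (ρ ::ₘ τ)) - ∑ i ∈ Finset.Icc 2
    ((Multiset.card (ρ ::ₘ τ) + 1) / 2), min (sotoT (ρ ::ₘ τ) i) 0 with hB
  refine ⟨max 0 (B - ρ), le_max_left _ _, ?_⟩
  have hε := le_max_left 0 (B - ρ)
  have hε' := le_max_right 0 (B - ρ)
  generalize max 0 (B - ρ) = ε at hε hε'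
  have hρ' : ∀ x ∈ τ, x ≤ ρ + ε := fun x hx => by linarith [hρ x hx]
  have hentry : ∀ i, 2 ≤ i → entry ((ρ + ε) ::ₘ τ) i = entry (ρ ::ₘ τ) i := fun i hi => by
    rw [entry_cons_of_two_le hρ hi, entry_cons_of_two_le hρ' hi]
  have hT : ∀ i ∈ Finset.Icc 2 ((Multiset.card τ + 1 + 1) / 2),
      min (sotoT ((ρ + ε) ::ₘ τ) i) 0 = min (sotoT (ρ ::ₘ τ) i) 0 := by
    intro i hi
    rw [Finset.mem_Icc] at hi
    simp only [sotoT, Multiset.card_cons]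
    rw [hentry i hi.1, hentry _ (by omega)]
  rw [sotoOne_iff, entry_cons_one hρ', Multiset.card_cons, hentry _ (by omega),
    Finset.sum_congr rfl hT]
  rw [Multiset.card_cons] at hB
  linarith

/-! ### The iterated Soto criteria -/

theorem le_fold_max_base (b : ℝ) (s : Multiset ℝ) : b ≤ s.fold max b := by
  induction s using Multiset.induction with
  | empty => simp
  | cons x s ih => rw [Multiset.fold_cons_left]; exact ih.trans (le_max_right _ _)

theorem le_fold_max_of_mem (b : ℝ) (s : Multiset ℝ) : ∀ x ∈ s, x ≤ s.fold max b := by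
  induction s using Multiset.induction with
  | empty => simp
  | cons y s ih =>
    intro x hx
    rw [Multiset.fold_cons_left]
    rcases Multiset.mem_cons.1 hx with rfl | hx
    exacts [le_max_left _ _, (ih x hx).trans (le_max_right _ _)]

section Step

variable {K : Multiset ℝ → Prop}

theorem brauerNegativity_nonneg (ρ : ℝ) (τ : Multiset ℝ) : 0 ≤ brauerNegativity K ρ τ :=
  Real.sInf_nonneg fun _ h => h.1

theorem brauerMargin_nonneg (ρ : ℝ) (τ : Multiset ℝ) : 0 ≤ brauerMargin K ρ τ :=
  Real.sSup_nonneg fun _ h => h.1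

/-- Since the feasible first entries form a closed half-line, the infimum defining the negativity
leads to a feasible list, whether or not it is attained for `K`. -/
theorem feasible_add_brauerNegativity
    (hK : ∀ ρ τ, (∀ x ∈ τ, x ≤ ρ) → K (ρ ::ₘ τ) → Feasible ρ τ) {ρ : ℝ} {τ : Multiset ℝ}
    (hρ : ∀ x ∈ τ, x ≤ ρ) (hne : ∃ ε, 0 ≤ ε ∧ K ((ρ + ε) ::ₘ τ)) :
    Feasible (ρ + brauerNegativity K ρ τ) τ := by
  obtain ⟨m, hm⟩ := Feasible.exists_threshold _ τ rfl
  rw [hm]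
  have : m - ρ ≤ brauerNegativity K ρ τ := by
    refine le_csInf hne fun ε hε => ?_
    have := (hm _).1 (hK (ρ + ε) τ (fun x hx => (hρ x hx).trans (by linarith [hε.1])) hε.2)
    linarith
  linarith

theorem feasible_sub_brauerMargin
    (hK : ∀ ρ τ, (∀ x ∈ τ, x ≤ ρ) → K (ρ ::ₘ τ) → Feasible ρ τ) {ρ : ℝ} {τ : Multiset ℝ}
    (hρ : ∀ x ∈ τ, x ≤ ρ) (h : K (ρ ::ₘ τ)) :
    Feasible (ρ - brauerMargin K ρ τ) τ := by
  obtain ⟨m, hm⟩ := Feasible.exists_threshold _ τ rfl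
  rw [hm]
  have : brauerMargin K ρ τ ≤ ρ - m := by
    refine csSup_le ⟨0, le_rfl, fun x hx => sub_nonneg.2 (hρ x hx), by rwa [sub_zero]⟩
      fun ε hε => ?_
    have := (hm _).1 (hK (ρ - ε) τ (fun x hx => by linarith [hε.2.1 x hx]) hε.2.2)
    linarith
  linarith

open Classical in
/-- The sublists are joined to `(ρ; τ)` one after the other, raising the root by the negativity of
each sublist that does not satisfy `K`. -/
theorem Feasible.add_sublists
    (hK : ∀ ρ τ, (∀ x ∈ τ, x ≤ ρ) → K (ρ ::ₘ τ) → Feasible ρ τ)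
    (hne : ∀ ρ τ, 0 ≤ ρ → (∀ x ∈ τ, x ≤ ρ) → ∃ ε, 0 ≤ ε ∧ K ((ρ + ε) ::ₘ τ))
    {γ : ℝ} {τ : Multiset ℝ} (h : Feasible γ τ) (s : Multiset (ℝ × Multiset ℝ))
    (hs : ∀ q ∈ s, 0 ≤ q.1 ∧ ∀ x ∈ q.2, x ≤ q.1) (hγ : ∀ q ∈ s, q.1 ≤ γ) :
    Feasible (γ + ((s.filter (fun q => ¬ K (q.1 ::ₘ q.2))).map
      (fun q => brauerNegativity K q.1 q.2)).sum) (τ + (s.map (fun q => q.1 ::ₘ q.2)).sum) := by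
  induction s using Multiset.induction with
  | empty => simpa using h
  | cons q s ih =>
    have ih := ih (fun q hq => hs q (Multiset.mem_cons_of_mem hq))
      fun q hq => hγ q (Multiset.mem_cons_of_mem hq)
    obtain ⟨hq₀, hq⟩ := hs q (Multiset.mem_cons_self q s)
    have hqγ : q.1 ≤ γ + ((s.filter (fun q => ¬ K (q.1 ::ₘ q.2))).map
        (fun q => brauerNegativity K q.1 q.2)).sum := by
      refine (hγ q (Multiset.mem_cons_self q s)).trans (le_add_of_nonneg_right ?_)
      refine Multiset.sum_nonneg fun x hx => ?_
      obtain ⟨q, -, rfl⟩ := Multiset.mem_map.1 hx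
      exact brauerNegativity_nonneg _ _
    rw [Multiset.map_cons, Multiset.sum_cons, add_left_comm, add_comm (q.1 ::ₘ q.2)]
    by_cases hKq : K (q.1 ::ₘ q.2)
    · rw [Multiset.filter_cons_of_neg (p := fun q : ℝ × Multiset ℝ => ¬ K (q.1 ::ₘ q.2)) _
        (not_not.2 hKq)]
      exact ih.union (hK _ _ hq hKq) hqγ
    · rw [Multiset.filter_cons_of_pos (p := fun q : ℝ × Multiset ℝ => ¬ K (q.1 ::ₘ q.2)) _ hKq,
        Multiset.map_cons, Multiset.sum_cons, add_left_comm,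
        add_comm (brauerNegativity K q.1 q.2)]
      exact ih.compensate (brauerNegativity_nonneg _ _)
        (feasible_add_brauerNegativity hK hq (hne _ _ hq₀ hq)) hqγ

theorem SotoStep.feasible
    (hK : ∀ ρ τ, (∀ x ∈ τ, x ≤ ρ) → K (ρ ::ₘ τ) → Feasible ρ τ)
    (hne : ∀ ρ τ, 0 ≤ ρ → (∀ x ∈ τ, x ≤ ρ) → ∃ ε, 0 ≤ ε ∧ K ((ρ + ε) ::ₘ τ))
    {ρ : ℝ} {τ : Multiset ℝ} (hρ : ∀ x ∈ τ, x ≤ ρ) (h : SotoStep K (ρ ::ₘ τ)) :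
    Feasible ρ τ := by
  obtain ⟨ρ', τ', s, e, hmax, -, hs, hKρ, hle⟩ := h
  have hτ' : ∀ x ∈ τ', x ≤ ρ' := fun x hx => hmax x (e ▸ by simp [hx])
  rw [Multiset.cons_add] at e
  obtain ⟨rfl, rfl⟩ := eq_of_cons_eq_cons_of_max e hρ fun x hx => hmax x
    (e ▸ Multiset.mem_cons_of_mem hx)
  have h1 := (feasible_sub_brauerMargin hK hτ' hKρ).mono
    (le_fold_max_base _ (s.map Prod.fst))
  exact (h1.add_sublists hK hne s hs fun q hq =>
    le_fold_max_of_mem _ _ _ (Multiset.mem_map_of_mem _ hq)).mono hle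

theorem SotoStep.of_criterion {ρ : ℝ} {τ : Multiset ℝ} (h0 : 0 ≤ ρ) (hρ : ∀ x ∈ τ, x ≤ ρ)
    (h : K (ρ ::ₘ τ)) : SotoStep K (ρ ::ₘ τ) := by
  refine ⟨ρ, τ, 0, by simp, by simpa using hρ, h0, by simp, h, ?_⟩
  simpa using brauerMargin_nonneg ρ τ

/-- A splitting `ρ → (a, b)` belonging to an entry `y ≥ 0` that dominates both `τ₁` and `τ₂` is an
instance of the step between criteria: the sublist `(y; τ₂)` has negativity at most `b - y`, and
`(ρ; τ₁)` has margin at least `ρ - a`. -/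
theorem SotoStep.of_node
    (hK : ∀ ρ τ, (∀ x ∈ τ, x ≤ ρ) → K (ρ ::ₘ τ) → Feasible ρ τ)
    {ρ a b y : ℝ} {τ₁ τ₂ : Multiset ℝ} (ha : a ≤ ρ) (hb : b ≤ ρ) (hab : a + b = ρ + y)
    (hy : 0 ≤ y) (h₁ : ∀ x ∈ τ₁, x ≤ a) (h₂ : ∀ x ∈ τ₂, x ≤ y) (hKa : K (a ::ₘ τ₁))
    (hKρ : K (ρ ::ₘ τ₁)) (hKb : K (b ::ₘ τ₂)) : SotoStep K (ρ ::ₘ y ::ₘ (τ₁ + τ₂)) := by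
  have hya : y ≤ a := by linarith
  have hyb : y ≤ b := by linarith
  have hmargin : ρ - a ≤ brauerMargin K ρ τ₁ := by
    refine le_csSup ⟨ρ, fun ε hε => ?_⟩ ⟨by linarith, fun x hx => by linarith [h₁ x hx], ?_⟩
    · have := (hK (ρ - ε) τ₁ (fun x hx => by linarith [hε.2.1 x hx]) hε.2.2).nonneg
      linarith
    · rwa [sub_sub_cancel]
  have hneg : brauerNegativity K y τ₂ ≤ b - y :=
    csInf_le ⟨0, fun ε hε => hε.1⟩ ⟨by linarith, by rwa [add_sub_cancel]⟩
  have hmax : max y (ρ - brauerMargin K ρ τ₁) ≤ a := max_le hya (by linarith)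
  refine ⟨ρ, τ₁, {(y, τ₂)}, by simp [Multiset.cons_swap], ?_, by linarith,
    by simpa using ⟨hy, h₂⟩, hKρ, ?_⟩
  · intro x hx
    simp only [Multiset.mem_cons, Multiset.mem_add] at hx
    rcases hx with rfl | rfl | hx | hx
    exacts [le_rfl, hya.trans ha, (h₁ x hx).trans ha, (h₂ x hx).trans (hya.trans ha)]
  · rw [Multiset.map_singleton, Multiset.fold_singleton, ge_iff_le, Multiset.filter_singleton]
    split_ifs
    · simp only [Multiset.empty_eq_zero, Multiset.map_zero, Multiset.sum_zero]
      linarith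
    · simp only [Multiset.map_singleton, Multiset.sum_singleton]
      linarith

end Step

theorem exists_sotoCriterion (p : ℕ) {ρ : ℝ} {τ : Multiset ℝ} (h0 : 0 ≤ ρ)
    (hρ : ∀ x ∈ τ, x ≤ ρ) : ∃ ε, 0 ≤ ε ∧ SotoCriterion (p + 1) ((ρ + ε) ::ₘ τ) := by
  induction p with
  | zero => exact exists_sotoOne h0 hρ
  | succ p ih =>
    obtain ⟨ε, hε, h⟩ := ih
    exact ⟨ε, hε, SotoStep.of_criterion (by linarith)
      (fun x hx => (hρ x hx).trans (by linarith)) h⟩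

theorem SotoCriterion.feasible (p : ℕ) : ∀ (ρ : ℝ) (τ : Multiset ℝ), (∀ x ∈ τ, x ≤ ρ) →
    SotoCriterion (p + 1) (ρ ::ₘ τ) → Feasible ρ τ := by
  induction p with
  | zero => exact fun ρ τ hρ h => SotoOne.feasible hρ h
  | succ p ih =>
    exact fun ρ τ hρ h => SotoStep.feasible ih (fun ρ τ h0 hρ => exists_sotoCriterion p h0 hρ) hρ h

theorem SotoCriterion.mono {p p' : ℕ} (hp : p ≤ p') {ρ : ℝ} {τ : Multiset ℝ} (h0 : 0 ≤ ρ)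
    (hρ : ∀ x ∈ τ, x ≤ ρ) (h : SotoCriterion (p + 1) (ρ ::ₘ τ)) :
    SotoCriterion (p' + 1) (ρ ::ₘ τ) := by
  induction hp with
  | refl => exact h
  | step _ ih => exact SotoStep.of_criterion h0 hρ ih

/-- Bring the largest entry `y` of `τ` to the root. If `y ≥ 0`, the splitting at the root is a step
between criteria; if `y < 0`, the first criterion holds. -/
theorem Feasible.exists_sotoCriterion : ∀ (n : ℕ) {ρ : ℝ} {τ : Multiset ℝ},
    Multiset.card τ = n → Feasible ρ τ → ∃ p, SotoCriterion (p + 1) (ρ ::ₘ τ) := by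
  intro n
  induction n using Nat.strong_induction_on with
  | _ n ih =>
  rintro ρ τ rfl h
  by_cases hneg : ∀ x ∈ τ, x < 0
  · exact ⟨0, h.sotoOne_of_neg hneg⟩
  push Not at hneg
  obtain ⟨x, hx, hx₀⟩ := hneg
  obtain ⟨y, hy, hmax⟩ : ∃ y ∈ τ, ∀ x ∈ τ, x ≤ y :=
    Multiset.exists_max_image id (by rintro rfl; simp at hx)
  have hy₀ := hx₀.trans (hmax x hx)
  obtain ⟨A, hA⟩ := h
  obtain ⟨a, b, τ₁, τ₂, A₁, A₂, h₁, h₂, ha, hb, hab, rfl, rfl⟩ := hA.exists_node_of_max y hy hmax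
  have hc₁ : Multiset.card τ₁ < Multiset.card (y ::ₘ (τ₁ + τ₂)) := by simp
  have hc₂ : Multiset.card τ₂ < Multiset.card (y ::ₘ (τ₁ + τ₂)) := by simp
  obtain ⟨p₁, k₁⟩ := ih _ hc₁ rfl ⟨A₁, h₁⟩
  obtain ⟨p₂, k₂⟩ := ih _ hc₁ rfl (Feasible.mono ⟨A₁, h₁⟩ ha)
  obtain ⟨p₃, k₃⟩ := ih _ hc₂ rfl ⟨A₂, h₂⟩
  set p := max p₁ (max p₂ p₃)
  refine ⟨p + 1, SotoStep.of_node (SotoCriterion.feasible p) ha hb hab hy₀ h₁.le_root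
    (fun x hx => hmax x (by simp [hx])) (k₁.mono ?_ h₁.root_nonneg h₁.le_root)
    (k₂.mono ?_ hA.root_nonneg fun x hx => (h₁.le_root x hx).trans ha)
    (k₃.mono ?_ h₂.root_nonneg h₂.le_root)⟩
  all_goals simp [p]

end SNIEP

/-- The list is `(ρ; τ)`, with `ρ` its largest entry and the other entries unordered. -/
theorem theorem4p1 (ρ : ℝ) (τ : Multiset ℝ) (hρ : ∀ x ∈ τ, x ≤ ρ) :
    List.TFAE [
      SNIEP.SoulesBar (ρ ::ₘ τ),
      SNIEP.InH (ρ ::ₘ τ),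
      SNIEP.CRealisable (ρ ::ₘ τ),
      ∃ p : ℕ, 1 ≤ p ∧ SNIEP.SotoCriterion p (ρ ::ₘ τ)] ∧
    ∀ a : Multiset ℝ, Multiset.card a = Multiset.card τ + 1 → (∀ x ∈ a, 0 ≤ x) →
      (SNIEP.SoulesBarWith (ρ ::ₘ τ) a ↔ SNIEP.HWith ρ τ a) := by
  constructor
  · tfae_have 1 ↔ 2 := by
      rw [SNIEP.inH_cons_iff hρ]
      exact exists_congr fun a => SNIEP.soulesBarWith_cons_iff hρ
    tfae_have 2 ↔ 3 := ⟨fun h => ((SNIEP.inH_cons_iff hρ).1 h).cRealisable, fun h => h.inH⟩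
    tfae_have 2 ↔ 4 := by
      rw [SNIEP.inH_cons_iff hρ]
      constructor
      · intro h
        obtain ⟨p, hp⟩ := h.exists_sotoCriterion _ rfl
        exact ⟨p + 1, Nat.succ_pos p, hp⟩
      · rintro ⟨p, hp, h⟩
        obtain ⟨p, rfl⟩ := Nat.exists_eq_succ_of_ne_zero (Nat.one_le_iff_ne_zero.1 hp)
        exact SNIEP.SotoCriterion.feasible p ρ τ hρ h
    tfae_finish
  · intro a _ _
    rw [SNIEP.soulesBarWith_cons_iff hρ, SNIEP.SplitTree.iff_hWith]
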